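/- Let $m\ge 2$, $n\ge 1$, $r>0$, and let $\Omega$ be a semicalibration of rank $m+1$ on $\mathbb{R}^{m+n}$, i.e. a smooth $(m+1)$-form with $|\Omega(u_1,\dots,u_{m+1})|\le 1$ for all orthonormal systems $u_i$. Let $\mathbb{R}^{m+1}\subset\mathbb{R}^{m+n}$ be an $\Omega$-calibrated vector subspace (with canonical orthonormal basis $\varepsilon_i$, so $\Omega(\varepsilon_1,\dots,\varepsilon_{m+1})=1$ at all its points), and let $\mathbb{S}^m_r$ be the sphere of radius $r$ about $0$ in $\mathbb{R}^{m+1}$, with mean curvature vector $H=-x/r^2$, so $\|H\|=1/r$, with unit normal $\nu=-x/r$, and oriented so that an orthonormal frame $e_1,\dots,e_m$ of its tangent space is direct when $(\nu,e_1,\dots,e_m)$ is a direct basis of $\mathbb{R}^{m+1}$. Let $W_\alpha$, $\alpha=m+2,\dots,m+n$, be a (constant) orthonormal basis of the orthogonal complement of $\mathbb{R}^{m+1}$. Let $\xi(W_\alpha,W_\beta)$ be the $1$-form on $\mathbb{S}^m_r$ with $$\xi(W_\alpha,W_\beta)(e_i)=\Omega(W_\alpha,e_1,\dots,e_{i-1},W_\beta,e_{i+1},\dots,e_m)$$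 for direct orthonormal frames $e_1,\dots,e_m$, and put $\Theta(r)=\sup_{\alpha<\beta}\sup_{\mathbb{S}^m_r}\|\xi(W_\alpha,W_\beta)\|$ (for $n\le 2$ there is no pair $\alpha<\beta$, and $\Theta(r)=0$). Let $\lambda_l=l(l+m-1)$ and $\lambda_l(r)=\lambda_l/r^2$, $l=0,1,2,\dots$, be the eigenvalues of $-\Delta$ on $\mathbb{S}^m$ and on $\mathbb{S}^m_r$, let $E_{\lambda_l(r)}$ be the eigenspaces on $\mathbb{S}^m_r$, and let $E^+_{\lambda_l(r)}$ be the $L^2$-orthogonal complement of $\sum_{1\le i\le l-1}E_{\lambda_i(r)}$. Suppose that for all $\alpha<\beta$ there is a smooth $2$-form $\omega_{\alpha\beta}$ on $\mathbb{S}^m_r$ with $\xi(W_\alpha,W_\beta)=\delta\omega_{\alpha\beta}$, where $\delta$ is the codifferential, and let $f_\alpha\in C^\infty(\mathbb{S}^m_r)\cap E^+_{\lambda_l(r)}$ for all $\alpha$. Then, if $l\ge 1$, $$\sum_{\alpha<\beta}-2m\|H\|\int_{\mathbb{S}^m_r}\omega_{\alpha\beta}(\nabla f_\alpha,\nabla f_\beta)\,dM\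 \le\ \frac{m(n-2)}{\sqrt{\lambda_l}}\,\Theta(r)\sum_\alpha\int_{\mathbb{S}^m_r}\|\nabla f_\alpha\|^2\,dM .$$ Hence, if $l\ge 0$ and $l(l+m-1)\ge m^2(n-2)^2$, the long integral Cauchy–Riemann inequality $$\sum_{\alpha<\beta}-2m\|H\|\int_{\mathbb{S}^m_r}\omega_{\alpha\beta}(\nabla f_\alpha,\nabla f_\beta)\,dM\ \le\ \sum_\alpha\int_{\mathbb{S}^m_r}\|\nabla f_\alpha\|^2\,dM$$ holds. -/

import Mathlib

open scoped RealInnerProductSpace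

namespace SphereCalibration

noncomputable section

/-- Euclidean space `ℝᵏ`. -/
abbrev Euc (k : ℕ) : Type := EuclideanSpace ℝ (Fin k)

/-! ### Forms on the ambient space -/

/-- A semicalibration of rank `m + 1` on `ℝᵏ`: a smooth differential `(m + 1)`-form whose value on
every orthonormal system of vectors is at most `1` in absolute value. -/
structure IsSemicalibration {m k : ℕ} (Ω : Euc k → Euc k [⋀^Fin (m + 1)]→L[ℝ] ℝ) : Prop where
  smooth : ContDiff ℝ (⊤ : ℕ∞) Ω
  le_one : ∀ (p : Euc k) (u : Fin (m + 1) → Euc k), Orthonormal ℝ u → |Ω p u| ≤ 1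

/-- The subspace `φ(ℝᵐ⁺¹)` of `ℝᵏ`, oriented by the image under the linear isometric embedding `φ`
of the canonical basis of `ℝᵐ⁺¹`, is `Ω`-calibrated: at each of its points `Ω` takes the value `1`
on that basis. -/
def IsCalibrated {m k : ℕ} (Ω : Euc k → Euc k [⋀^Fin (m + 1)]→L[ℝ] ℝ)
    (φ : Euc (m + 1) →ₗᵢ[ℝ] Euc k) : Prop :=
  ∀ x : Euc (m + 1), Ω (φ x) (fun i => φ (EuclideanSpace.single i (1 : ℝ))) = 1

/-! ### Calculus on the sphere of radius `r` about `0` in `ℝᵐ⁺¹`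

A function (or tensor) on the sphere `‖x‖ = r` is represented by a map on `ℝᵐ⁺¹` of which only the
values on the sphere are used.  The tangent space at `x` is the orthogonal complement of `x`. -/

/-- The extension of a map `g` on the sphere of radius `r` to `ℝᵐ⁺¹ ∖ {0}` that is constant along
rays; it uses only the values of `g` on the sphere. -/
def radialExt {m : ℕ} {V : Type*} (r : ℝ) (g : Euc (m + 1) → V) : Euc (m + 1) → V :=
  fun y => g ((r / ‖y‖) • y)

/-- `g` is a smooth map on the sphere of radius `r`. -/
def SmoothOnSphere {m : ℕ} {V : Type*} [NormedAddCommGroup V] [NormedSpace ℝ V]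
    (r : ℝ) (g : Euc (m + 1) → V) : Prop :=
  ContDiffOn ℝ (⊤ : ℕ∞) (radialExt r g) {0}ᶜ

/-- `e` is a direct orthonormal frame of the tangent space at `x` of the sphere of radius `r`, for
the orientation for which `(ν, e₁, …, eₘ)` is a direct orthonormal basis of `ℝᵐ⁺¹`; here
`ν = - x / r` is the unit normal in the direction of the mean curvature vector `H = - x / r²`. -/
structure IsDirectFrame {m : ℕ} (r : ℝ) (x : Euc (m + 1)) (e : Fin m → Euc (m + 1)) : Prop where
  orthonormal : Orthonormal ℝ e
  tangent : ∀ i, ⟪x, e i⟫ = 0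
  direct : (EuclideanSpace.basisFun (Fin (m + 1)) ℝ).toBasis.det
    (Fin.cons (-(1 / r) • x) e : Fin (m + 1) → Euc (m + 1)) = 1

/-- A direct orthonormal frame at `x`. -/
def directFrame {m : ℕ} (r : ℝ) (x : Euc (m + 1)) : Fin m → Euc (m + 1) :=
  Classical.epsilon (IsDirectFrame r x)

/-- Direct orthonormal frames exist at each point of a sphere of dimension `m ≥ 1`. -/
theorem directFrame_spec {m : ℕ} (hm : 1 ≤ m) {r : ℝ} (hr : 0 < r) {x : Euc (m + 1)}
    (hx : ‖x‖ = r) : IsDirectFrame r x (directFrame r x) := by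
  have h : ∃ e, IsDirectFrame r x e := by
    have hx0 : x ≠ 0 := by
      rintro rfl
      simp at hx
      exact hr.ne hx
    have hfin : Module.finrank ℝ (ℝ ∙ x)ᗮ = m := by
      have : Fact (Module.finrank ℝ (Euc (m + 1)) = m + 1) := ⟨by simp⟩
      exact Submodule.finrank_orthogonal_span_singleton hx0
    let b := (stdOrthonormalBasis ℝ (ℝ ∙ x)ᗮ).reindex (finCongr hfin)
    let e : Fin m → Euc (m + 1) := fun i => (b i : Euc (m + 1))
    have he : Orthonormal ℝ e := b.orthonormal.comp_linearIsometry (ℝ ∙ x)ᗮ.subtypeₗᵢ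
    have ht : ∀ i, ⟪x, e i⟫ = 0 := fun i =>
      (Submodule.mem_orthogonal_singleton_iff_inner_right).1 (b i).2
    have key : ∀ e : Fin m → Euc (m + 1), Orthonormal ℝ e → (∀ i, ⟪x, e i⟫ = 0) →
        Orthonormal ℝ (Fin.cons (-(1 / r) • x) e : Fin (m + 1) → Euc (m + 1)) := by
      intro e he ht
      constructor
      · intro i
        refine Fin.cases ?_ (fun j => ?_) i
        · simp only [Fin.cons_zero, norm_smul, hx]
          rw [norm_neg, Real.norm_of_nonneg (by positivity)]
          field_simp
        · simpa using he.1 j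
      · intro i j
        refine Fin.cases ?_ (fun i => ?_) i <;> refine Fin.cases ?_ (fun j => ?_) j
        · simp
        · intro _
          simp [inner_smul_left, ht]
        · intro _
          simp [inner_smul_right, real_inner_comm, ht]
        · intro hij
          simpa using he.2 (fun h => hij (by rw [h]))
    let d := (EuclideanSpace.basisFun (Fin (m + 1)) ℝ).toBasis.det
    have hd : ∀ v : Fin (m + 1) → Euc (m + 1), Orthonormal ℝ v → d v = 1 ∨ d v = -1 := by
      intro v hv
      let B := OrthonormalBasis.mk hv
        (hv.linearIndependent.span_eq_top_of_card_eq_finrank (by simp)).ge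
      have hB : (B : Fin (m + 1) → Euc (m + 1)) = v := OrthonormalBasis.coe_mk _ _
      have := (EuclideanSpace.basisFun (Fin (m + 1)) ℝ).det_to_matrix_orthonormalBasis_real B
      rw [hB] at this
      exact this
    rcases hd _ (key e he ht) with h1 | h1
    · exact ⟨e, he, ht, h1⟩
    · let i₀ : Fin m := ⟨0, hm⟩
      have hval : ∀ i, Function.update e i₀ (-e i₀) i = e i ∨
          Function.update e i₀ (-e i₀) i = -e i := by
        intro i
        by_cases hi : i = i₀
        · subst hi
          simp
        · simp [hi]
      refine ⟨Function.update e i₀ (-e i₀), ⟨?_, ?_⟩, ?_, ?_⟩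
      · intro i
        rcases hval i with h | h <;> rw [h] <;> simp [he.1 i]
      · intro i j hij
        rcases hval i with h | h <;> rcases hval j with h' | h' <;> simp [h, h', he.2 hij]
      · intro i
        rcases hval i with h | h <;> simp [h, ht i]
      · change d _ = 1
        rw [Fin.cons_update, show -e i₀ = (-1 : ℝ) •
          (Fin.cons (-(1 / r) • x) e : Fin (m + 1) → Euc (m + 1)) i₀.succ by simp,
          d.map_update_smul, Function.update_eq_self, h1]
        simp
  exact Classical.epsilon_spec h

/-- The Riemannian gradient of a function on the sphere.  The gradient of the radial extension is
tangent to the sphere. -/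
def grad {m : ℕ} (r : ℝ) (f : Euc (m + 1) → ℝ) (x : Euc (m + 1)) : Euc (m + 1) :=
  gradient (radialExt r f) x

/-- The divergence `∑ᵢ ⟨∇_{eᵢ} X, eᵢ⟩` of a tangent vector field `X` on the sphere: `∇_{eᵢ} X` is
the tangential part of the derivative of `X` in the direction `eᵢ`. -/
def divergence {m : ℕ} (r : ℝ) (X : Euc (m + 1) → Euc (m + 1)) (x : Euc (m + 1)) : ℝ :=
  ∑ i, ⟪fderiv ℝ (radialExt r X) x (directFrame r x i), directFrame r x i⟫

/-- The Laplace–Beltrami operator `Δ f = div (∇ f)` of the sphere. -/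
def laplaceBeltrami {m : ℕ} (r : ℝ) (f : Euc (m + 1) → ℝ) (x : Euc (m + 1)) : ℝ :=
  divergence r (grad r f) x

/-- `ω` is a smooth `2`-form on the sphere of radius `r`.  A `2`-form on the tangent space at `x` is
identified with the `2`-form on `ℝᵐ⁺¹` that extends it and vanishes when one argument is `x`. -/
structure IsTwoForm {m : ℕ} (r : ℝ) (ω : Euc (m + 1) → Euc (m + 1) [⋀^Fin 2]→L[ℝ] ℝ) :
    Prop where
  tangential : ∀ x, ‖x‖ = r → ∀ v, ω x ![x, v] = 0
  smooth : SmoothOnSphere r ω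

/-- The codifferential `(δω)(v) = - ∑ᵢ (∇_{eᵢ} ω)(eᵢ, v)` of a `2`-form on the sphere.  As `ω`
vanishes on normal vectors, on tangent vectors `∇_{eᵢ} ω` is the derivative of `ω` in the direction
`eᵢ`. -/
def codifferential {m : ℕ} (r : ℝ) (ω : Euc (m + 1) → Euc (m + 1) [⋀^Fin 2]→L[ℝ] ℝ)
    (x v : Euc (m + 1)) : ℝ :=
  -∑ i, (fderiv ℝ (radialExt r ω) x (directFrame r x i)) ![directFrame r x i, v]

/-- The integral over the sphere of radius `r` with respect to its Riemannian volume, through the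
volume of the unit sphere. -/
def sphereIntegral {m : ℕ} (r : ℝ) (g : Euc (m + 1) → ℝ) : ℝ :=
  r ^ m * ∫ y : Metric.sphere (0 : Euc (m + 1)) 1,
    g (r • (y : Euc (m + 1))) ∂(MeasureTheory.volume : MeasureTheory.Measure (Euc (m + 1))).toSphere

/-! ### The spectrum of the sphere -/

/-- The eigenvalue `λ_l(r) = l (l + m - 1) / r²`. -/
def eigval (m : ℕ) (r : ℝ) (l : ℕ) : ℝ := (l : ℝ) * ((l : ℝ) + (m : ℝ) - 1) / r ^ 2

/-- `g` lies in the eigenspace `E_{λ_l(r)}`: it is smooth and `-Δ g = λ_l(r) g` on the sphere. -/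
structure MemEigenspace {m : ℕ} (r : ℝ) (l : ℕ) (g : Euc (m + 1) → ℝ) : Prop where
  smooth : SmoothOnSphere r g
  eigen : ∀ x, ‖x‖ = r → -laplaceBeltrami r g x = eigval m r l * g x

/-- The smooth function `f` lies in `E⁺_{λ_l(r)}`: it is `L²`-orthogonal to the eigenspaces
`E_{λ_i(r)}` with `1 ≤ i ≤ l - 1`. -/
structure MemEplus {m : ℕ} (r : ℝ) (l : ℕ) (f : Euc (m + 1) → ℝ) : Prop where
  smooth : SmoothOnSphere r f
  orthogonal : ∀ i : ℕ, 1 ≤ i → i < l → ∀ g : Euc (m + 1) → ℝ, MemEigenspace r i g →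
    sphereIntegral r (fun x => f x * g x) = 0

/-! ### The long integral Cauchy–Riemann inequality -/

/-- The `1`-form `ξ(W, W')` on the sphere, as a covector on `ℝᵐ⁺¹` that vanishes on the normal
vector `x`: `ξ(W, W')(eᵢ) = Ω(W, e₁, …, W', …, eₘ)` with `W'` in the place of `eᵢ`, for a direct
orthonormal frame `e₁, …, eₘ` of the tangent space at `x`; the value does not depend on the
frame. -/
def xi {m k : ℕ} (Ω : Euc k → Euc k [⋀^Fin (m + 1)]→L[ℝ] ℝ) (φ : Euc (m + 1) →ₗᵢ[ℝ] Euc k)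
    (r : ℝ) (W W' : Euc k) (x : Euc (m + 1)) : Euc (m + 1) →L[ℝ] ℝ :=
  ∑ i, Ω (φ x) (Fin.cons W (Function.update (fun j => φ (directFrame r x j)) i W')) •
    innerSL ℝ (directFrame r x i)

/-- `Θ(r)`, the supremum over `α < β` and over the points `x` of the sphere of the norm of
`ξ(W_α, W_β)` at `x`. -/
def Theta {m k N : ℕ} (Ω : Euc k → Euc k [⋀^Fin (m + 1)]→L[ℝ] ℝ) (φ : Euc (m + 1) →ₗᵢ[ℝ] Euc k)
    (r : ℝ) (W : Fin N → Euc k) : ℝ :=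
  ⨆ p : {p : Fin N × Fin N // p.1 < p.2}, ⨆ x : Metric.sphere (0 : Euc (m + 1)) r,
    ‖xi Ω φ r (W p.1.1) (W p.1.2) x‖

/-- The long Cauchy–Riemann form `∑_{α<β} -2 m ‖H‖ ∫ ω_{αβ}(∇f_α, ∇f_β)`, where `‖H‖ = 1 / r` for
the sphere of radius `r`. -/
def longForm {m N : ℕ} (r : ℝ) (ω : Fin N → Fin N → Euc (m + 1) → Euc (m + 1) [⋀^Fin 2]→L[ℝ] ℝ)
    (f : Fin N → Euc (m + 1) → ℝ) : ℝ :=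
  ∑ α, ∑ β ∈ Finset.Ioi α, -2 * (m : ℝ) * (1 / r) *
    sphereIntegral r (fun x => ω α β x ![grad r (f α) x, grad r (f β) x])

/-- The energy `∑_α ∫ ‖∇f_α‖²`. -/
def energy {m N : ℕ} (r : ℝ) (f : Fin N → Euc (m + 1) → ℝ) : ℝ :=
  ∑ α, sphereIntegral r (fun x => ‖grad r (f α) x‖ ^ 2)

end

end SphereCalibration

open SphereCalibration

/-! Write `N = n - 1` for the number of normal directions. For one pair `α < β`, set `f = f_α`, `g =
f_β`. The contraction `ω(·, ∇g)` has divergence `-δω(∇g)`, because the symmetric Hessian of `g` is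
annihilated by the alternating `ω`. Green's formula thus gives `∫ ω(∇f, ∇g) = ∫ (f - c) δω(∇g)` for
every constant `c`, with one derivative fewer on `f`. As `δω = ξ` is bounded by `Θ`, Young's
inequality with weight `s = √λ_l / r` bounds `-2 ∫ ω(∇f, ∇g)` by `Θ s ∫ (f - c)² + (Θ / s) ∫ ‖∇g‖²`.
The Poincaré inequality `s² ∫ (f - c)² ≤ ∫ ‖∇f‖²` turns this into `Θ / s` times the sum of the two
energies (`neg_two_mul_sphereIntegral_twoForm_grad_le`). The factor `m / r` cancels the radius in
`s`, and each index lies in `N - 1 = n - 2` pairs, which gives the first estimate. The second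
follows from `Θ ≤ 1`: the arguments of `Ω` in `ξ` can be taken orthonormal (`abs_xi_le`).

Two analytic facts carry this. The divergence theorem on the sphere (`sphereIntegral_divergence`)
comes from integrating the divergence of a compactly supported field on `ℝᵐ⁺¹` in polar coordinates.
The Poincaré inequality (`MemEplus.exists_poincare`) is obtained without a spectral theorem:
homogeneous harmonic polynomials restrict to eigenfunctions, their sums are uniformly dense by
Stone–Weierstrass, and completing a square against such a sum controls the energy up to the
approximation error. -/

open scoped RealInnerProductSpace

namespace SphereCalibration

/-! ### Radial extension and gradient on the sphere -/

section Sphere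

variable {m : ℕ} {r : ℝ} {V : Type*}

theorem radialExt_of_norm_eq (hr : 0 < r) (g : Euc (m + 1) → V) {x : Euc (m + 1)}
    (hx : ‖x‖ = r) : radialExt r g x = g x := by
  simp [radialExt, hx, div_self hr.ne']

theorem radialExt_smul (g : Euc (m + 1) → V) {t : ℝ} (ht : 0 < t) (y : Euc (m + 1)) :
    radialExt r g (t • y) = radialExt r g y := by
  unfold radialExt
  congr 1
  rw [norm_smul, Real.norm_of_nonneg ht.le, smul_smul]
  congr 1
  by_cases hy : ‖y‖ = 0
  · simp [hy]
  · field_simp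

theorem norm_normalize (hr : 0 < r) {y : Euc (m + 1)} (hy : y ≠ 0) : ‖(r / ‖y‖) • y‖ = r := by
  have : ‖y‖ ≠ 0 := norm_ne_zero_iff.2 hy
  rw [norm_smul, Real.norm_of_nonneg (by positivity)]
  field_simp

theorem ne_zero_of_norm_eq (hr : 0 < r) {x : Euc (m + 1)} (hx : ‖x‖ = r) : x ≠ 0 := by
  rintro rfl
  simp at hx
  exact hr.ne hx

theorem contDiffOn_normalize (r : ℝ) :
    ContDiffOn ℝ (⊤ : ℕ∞) (fun y : Euc (m + 1) => (r / ‖y‖) • y) {0}ᶜ := by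
  intro y hy
  have hy : y ≠ 0 := hy
  have h1 : ContDiffAt ℝ (⊤ : ℕ∞) (fun y : Euc (m + 1) => r / ‖y‖) y :=
    contDiffAt_const.div (contDiffAt_norm ℝ hy) (norm_ne_zero_iff.2 hy)
  exact (h1.smul contDiffAt_id).contDiffWithinAt

/-- The derivative of the radial projection at a point of the sphere is the tangential projection. -/
theorem hasFDerivAt_normalize (hr : 0 < r) {x : Euc (m + 1)} (hx : ‖x‖ = r) :
    HasFDerivAt (fun y : Euc (m + 1) => (r / ‖y‖) • y)
      (ContinuousLinearMap.id ℝ (Euc (m + 1)) - ((1 / r ^ 2) • innerSL ℝ x).smulRight x) x := by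
  have hx0 := ne_zero_of_norm_eq hr hx
  have hsq : HasFDerivAt (fun y : Euc (m + 1) => ‖y‖ ^ 2) (2 • innerSL ℝ x) x :=
    (hasStrictFDerivAt_norm_sq x).hasFDerivAt
  have hs := hsq.sqrt (by rw [hx]; positivity)
  have h1 : HasFDerivAt (fun y : Euc (m + 1) => ‖y‖) ((1 / r) • innerSL ℝ x) x := by
    have e : (fun y : Euc (m + 1) => √(‖y‖ ^ 2)) = fun y => ‖y‖ := by
      ext y; exact Real.sqrt_sq (norm_nonneg y)
    rw [e] at hs
    refine hs.congr_fderiv (ContinuousLinearMap.ext fun u => ?_)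
    rw [hx, Real.sqrt_sq hr.le]
    simp
    field_simp
  have h2 : HasFDerivAt (fun y : Euc (m + 1) => r / ‖y‖) (-(1 / r ^ 2) • innerSL ℝ x) x := by
    have := (hasDerivAt_inv (norm_ne_zero_iff.2 hx0)).comp_hasFDerivAt x h1
    have h3 := this.const_mul r
    refine h3.congr_fderiv (ContinuousLinearMap.ext fun u => ?_)
    simp [hx]
    field_simp
  refine (h2.smul (hasFDerivAt_id x)).congr_fderiv (ContinuousLinearMap.ext fun u => ?_)
  simp [hx, div_self hr.ne', sub_eq_add_neg, neg_smul]

variable [NormedAddCommGroup V] [NormedSpace ℝ V]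

/-- Chain rule through the tangential projection. In tangent directions any differentiable ambient
extension may therefore replace the radial one. -/
theorem fderiv_radialExt (hr : 0 < r) {F : Euc (m + 1) → V} {x : Euc (m + 1)} (hx : ‖x‖ = r)
    (hF : DifferentiableAt ℝ F x) (u : Euc (m + 1)) :
    fderiv ℝ (radialExt r F) x u = fderiv ℝ F x (u - (⟪x, u⟫ / r ^ 2) • x) := by
  have hN : (r / ‖x‖) • x = x := by simp [hx, div_self hr.ne']
  have hF' : HasFDerivAt F (fderiv ℝ F x) ((r / ‖x‖) • x) := by
    rw [hN]; exact hF.hasFDerivAt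
  have := (HasFDerivAt.comp (f := fun y : Euc (m + 1) => (r / ‖y‖) • y) x hF'
    (hasFDerivAt_normalize hr hx)).fderiv
  change fderiv ℝ (F ∘ fun y : Euc (m + 1) => (r / ‖y‖) • y) x u = _
  rw [this, ContinuousLinearMap.comp_apply]
  congr 1
  simp [div_eq_inv_mul]

theorem fderiv_radialExt_self {X : Euc (m + 1) → V} (hr : 0 < r) {x : Euc (m + 1)}
    (hx : ‖x‖ = r) (hX : DifferentiableAt ℝ (radialExt r X) x) :
    fderiv ℝ (radialExt r X) x x = 0 := by
  have hX' : radialExt r (radialExt r X) = radialExt r X := by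
    ext y
    by_cases hy : y = 0
    · subst hy
      simp [radialExt]
    · have : 0 < r / ‖y‖ := div_pos hr (norm_pos_iff.2 hy)
      exact radialExt_smul X this y
  have := fderiv_radialExt hr hx hX x
  rw [hX'] at this
  rw [this, real_inner_self_eq_norm_sq, hx, div_self (by positivity)]
  simp

theorem SmoothOnSphere.differentiableAt {g : Euc (m + 1) → V} (hg : SmoothOnSphere r g)
    {x : Euc (m + 1)} (hx : x ≠ 0) : DifferentiableAt ℝ (radialExt r g) x :=
  (hg.contDiffAt (isOpen_compl_singleton.mem_nhds hx)).differentiableAt (by simp)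

theorem smoothOnSphere_of_contDiffOn (hr : 0 < r) {F : Euc (m + 1) → V}
    (hF : ContDiffOn ℝ (⊤ : ℕ∞) F {0}ᶜ) : SmoothOnSphere r F :=
  ContDiffOn.comp hF (contDiffOn_normalize r) fun _ hy =>
    ne_zero_of_norm_eq hr (norm_normalize hr hy)

theorem SmoothOnSphere.continuous_unitSphere {g : Euc (m + 1) → V}
    (hg : SmoothOnSphere r g) :
    Continuous fun y : Metric.sphere (0 : Euc (m + 1)) 1 => g (r • (y : Euc (m + 1))) := by
  have h1 : ContinuousOn (radialExt r g) {0}ᶜ := hg.continuousOn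
  have h2 : (fun y : Metric.sphere (0 : Euc (m + 1)) 1 => g (r • (y : Euc (m + 1)))) =
      fun y : Metric.sphere (0 : Euc (m + 1)) 1 => radialExt r g y := by
    ext y
    simp [radialExt]
  rw [h2]
  exact h1.comp_continuous continuous_subtype_val fun y => by
    intro h
    have := norm_eq_of_mem_sphere y
    rw [Set.mem_singleton_iff.1 h] at this
    simp at this

theorem contDiffOn_gradient {F : Euc (m + 1) → ℝ} (hF : ContDiffOn ℝ (⊤ : ℕ∞) F {0}ᶜ) :
    ContDiffOn ℝ (⊤ : ℕ∞) (gradient F) {0}ᶜ := by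
  have h1 : ContDiffOn ℝ (⊤ : ℕ∞) (fderiv ℝ F) {0}ᶜ :=
    hF.fderiv_of_isOpen isOpen_compl_singleton (by simp)
  exact (InnerProductSpace.toDual ℝ (Euc (m + 1))).symm.contDiff.comp_contDiffOn h1

theorem smoothOnSphere_grad (hr : 0 < r) {f : Euc (m + 1) → ℝ} (hf : SmoothOnSphere r f) :
    SmoothOnSphere r (grad r f) :=
  smoothOnSphere_of_contDiffOn hr (contDiffOn_gradient hf)

theorem inner_grad (f : Euc (m + 1) → ℝ) (x u : Euc (m + 1)) :
    ⟪grad r f x, u⟫ = fderiv ℝ (radialExt r f) x u := by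
  simp [grad, gradient]

theorem inner_self_grad (hr : 0 < r) {f : Euc (m + 1) → ℝ} (hf : SmoothOnSphere r f)
    {x : Euc (m + 1)} (hx : ‖x‖ = r) : ⟪x, grad r f x⟫ = 0 := by
  rw [real_inner_comm, inner_grad,
    fderiv_radialExt_self hr hx (hf.differentiableAt (ne_zero_of_norm_eq hr hx))]

end Sphere

open MeasureTheory

/-! ### The divergence theorem on the sphere -/

section Divergence

variable {m : ℕ} {r : ℝ}

theorem IsDirectFrame.orthonormal_cons (hr : 0 < r) {x : Euc (m + 1)} (hx : ‖x‖ = r)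
    {e : Fin m → Euc (m + 1)} (he : IsDirectFrame r x e) :
    Orthonormal ℝ (Fin.cons (-(1 / r) • x) e : Fin (m + 1) → Euc (m + 1)) := by
  constructor
  · intro i
    refine Fin.cases ?_ (fun j => ?_) i
    · simp only [Fin.cons_zero, norm_smul, hx]
      rw [norm_neg, Real.norm_of_nonneg (by positivity)]
      field_simp
    · simpa using he.orthonormal.1 j
  · intro i j
    refine Fin.cases ?_ (fun i => ?_) i <;> refine Fin.cases ?_ (fun j => ?_) j
    · simp
    · intro _
      simp [inner_smul_left, he.tangent]
    · intro _
      simp [inner_smul_right, real_inner_comm, he.tangent]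
    · intro hij
      simpa using he.orthonormal.2 (fun h => hij (by rw [h]))

/-- The orthonormal basis of `ℝᵐ⁺¹` formed by the unit normal and a direct frame. -/
theorem IsDirectFrame.exists_basis (hr : 0 < r) {x : Euc (m + 1)} (hx : ‖x‖ = r)
    {e : Fin m → Euc (m + 1)} (he : IsDirectFrame r x e) :
    ∃ b : OrthonormalBasis (Fin (m + 1)) ℝ (Euc (m + 1)),
      b 0 = -(1 / r) • x ∧ ∀ i : Fin m, b i.succ = e i := by
  have ho := he.orthonormal_cons hr hx
  let b := OrthonormalBasis.mk ho
    (ho.linearIndependent.span_eq_top_of_card_eq_finrank (by simp)).ge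
  have hb : (b : Fin (m + 1) → Euc (m + 1)) = Fin.cons (-(1 / r) • x) e :=
    OrthonormalBasis.coe_mk _ _
  exact ⟨b, by rw [hb]; simp, fun i => by rw [hb]; simp⟩

theorem sum_inner_directFrame (hm : 1 ≤ m) (hr : 0 < r) {x : Euc (m + 1)} (hx : ‖x‖ = r)
    (T : Euc (m + 1) →ₗ[ℝ] Euc (m + 1)) :
    ∑ i, ⟪T (directFrame r x i), directFrame r x i⟫ =
      LinearMap.trace ℝ _ T - ⟪T x, x⟫ / r ^ 2 := by
  obtain ⟨b, hb0, hb⟩ := (directFrame_spec hm hr hx).exists_basis hr hx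
  rw [LinearMap.trace_eq_sum_inner T b, Fin.sum_univ_succ, hb0]
  simp only [hb, map_smul, inner_smul_left, inner_smul_right]
  have : (∑ i, ⟪directFrame r x i, T (directFrame r x i)⟫) =
      ∑ i, ⟪T (directFrame r x i), directFrame r x i⟫ :=
    Finset.sum_congr rfl fun i _ => real_inner_comm _ _
  rw [this, real_inner_comm x (T x)]
  simp
  field_simp
  ring

/-- Expansion of a tangent vector in the direct frame. -/
theorem sum_inner_smul_directFrame (hm : 1 ≤ m) (hr : 0 < r) {x : Euc (m + 1)} (hx : ‖x‖ = r)
    (u : Euc (m + 1)) :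
    ∑ i, ⟪directFrame r x i, u⟫ • directFrame r x i = u - (⟪x, u⟫ / r ^ 2) • x := by
  obtain ⟨b, hb0, hb⟩ := (directFrame_spec hm hr hx).exists_basis hr hx
  have := b.sum_repr' u
  rw [Fin.sum_univ_succ, hb0] at this
  simp only [hb] at this
  rw [eq_sub_iff_add_eq]
  refine (add_comm _ _).trans (Eq.trans ?_ this)
  congr 1
  simp only [inner_smul_left, smul_smul]
  congr 1
  simp
  field_simp

/-- The normal direction adds nothing to the trace, as the extension is constant along rays. The
trace does not see the frame; this matters because `directFrame` is an arbitrary choice at each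
point, with no continuity. -/
theorem divergence_eq_trace (hm : 1 ≤ m) (hr : 0 < r) {X : Euc (m + 1) → Euc (m + 1)}
    (hX : SmoothOnSphere r X) {x : Euc (m + 1)} (hx : ‖x‖ = r) :
    divergence r X x = LinearMap.trace ℝ _ (fderiv ℝ (radialExt r X) x).toLinearMap := by
  have := sum_inner_directFrame hm hr hx (fderiv ℝ (radialExt r X) x).toLinearMap
  simp only [ContinuousLinearMap.coe_coe] at this
  rw [divergence, this,
    fderiv_radialExt_self hr hx (hX.differentiableAt (ne_zero_of_norm_eq hr hx))]
  simp

theorem fderiv_radialExt_smul (X : Euc (m + 1) → Euc (m + 1)) {t : ℝ} (ht : 0 < t)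
    (y : Euc (m + 1)) :
    fderiv ℝ (radialExt r X) y = t • fderiv ℝ (radialExt r X) (t • y) := by
  rw [← fderiv_comp_smul]
  congr 1
  ext z
  rw [radialExt_smul X ht]

/-- Integration by parts against the constant `1`; only the products with `F` and its derivative
need to be integrable. -/
theorem integral_fderiv_apply_eq_zero {k : ℕ} {F : Euc k → ℝ} (hF : ContDiff ℝ 1 F)
    (hc : HasCompactSupport F) (v : Euc k) : ∫ y, fderiv ℝ F y v = 0 := by
  have h1 : Integrable (fun y => fderiv ℝ F y v) :=
    ((hF.continuous_fderiv (by simp)).clm_apply continuous_const).integrable_of_hasCompactSupport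
      (hc.fderiv_apply (𝕜 := ℝ) v)
  have h2 : Integrable F := hF.continuous.integrable_of_hasCompactSupport hc
  have := integral_mul_fderiv_eq_neg_fderiv_mul_of_integrable (μ := volume)
    (f := fun _ : Euc k => (1 : ℝ)) (g := F) (v := v)
    (by simp) (by simpa using h1) (by simpa using h2)
    (fun x _ => by simp) (fun x _ => (hF.differentiable (by simp)) x)
  simpa using this

theorem integral_trace_fderiv_eq_zero {k : ℕ} {Y : Euc k → Euc k} (hY : ContDiff ℝ 1 Y)
    (hc : HasCompactSupport Y) : ∫ y, LinearMap.trace ℝ _ (fderiv ℝ Y y).toLinearMap = 0 := by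
  let b := EuclideanSpace.basisFun (Fin k) ℝ
  have hF : ∀ i, ContDiff ℝ 1 fun y => ⟪b i, Y y⟫ := fun i => contDiff_const.inner ℝ hY
  have hFc : ∀ i, HasCompactSupport fun y => ⟪b i, Y y⟫ := fun i =>
    hc.comp_left (g := fun z => ⟪b i, z⟫) (by simp)
  have h : ∀ y, LinearMap.trace ℝ _ (fderiv ℝ Y y).toLinearMap =
      ∑ i, fderiv ℝ (fun y => ⟪b i, Y y⟫) y (b i) := by
    intro y
    rw [LinearMap.trace_eq_sum_inner _ b]
    refine Finset.sum_congr rfl fun i _ => ?_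
    rw [fderiv_inner_apply ℝ (by fun_prop) (hY.differentiable (by simp) y)]
    simp
  simp_rw [h]
  rw [integral_finsetSum]
  · exact Finset.sum_eq_zero fun i _ => integral_fderiv_apply_eq_zero (hF i) (hFc i) _
  · intro i _
    exact (((hF i).continuous_fderiv (by simp)).clm_apply
      continuous_const).integrable_of_hasCompactSupport ((hFc i).fderiv_apply (𝕜 := ℝ) _)

/-- Polar coordinates and Fubini for a function that splits into an angular and a radial factor. -/
theorem integral_mul_polar {k : ℕ} (G : Euc (k + 1) → ℝ) (a : ℝ → ℝ)
    (g : Metric.sphere (0 : Euc (k + 1)) 1 → ℝ)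
    (h : ∀ (y : Metric.sphere (0 : Euc (k + 1)) 1) (t : ℝ), 0 < t →
      G (t • (y : Euc (k + 1))) = g y * a t) :
    ∫ y, G y = (∫ y, g y ∂(volume : Measure (Euc (k + 1))).toSphere) *
      ∫ t : Set.Ioi (0 : ℝ), a t ∂Measure.volumeIoiPow (Module.finrank ℝ (Euc (k + 1)) - 1) := by
  calc
    ∫ y, G y = ∫ y : ({(0)}ᶜ : Set (Euc (k + 1))), G y ∂(volume.comap Subtype.val) := by
      rw [integral_subtype_comap (measurableSet_singleton _).compl G,
        restrict_compl_singleton]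
    _ = ∫ p, g p.1 * a p.2 ∂(volume : Measure (Euc (k + 1))).toSphere.prod
        (.volumeIoiPow (Module.finrank ℝ (Euc (k + 1)) - 1)) := by
      rw [← (volume : Measure
        (Euc (k + 1))).measurePreserving_homeomorphUnitSphereProd.integral_comp
        (Homeomorph.measurableEmbedding _) fun p => g p.1 * a p.2]
      refine integral_congr_ae (Filter.Eventually.of_forall fun y => ?_)
      have := h (homeomorphUnitSphereProd _ y).1 (homeomorphUnitSphereProd _ y).2
        (homeomorphUnitSphereProd _ y).2.2
      refine Eq.trans ?_ this
      have hy : ‖(y : Euc (k + 1))‖ ≠ 0 := norm_ne_zero_iff.2 y.2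
      simp [smul_smul, hy]
    _ = _ := integral_prod_mul (L := ℝ) g fun t : Set.Ioi (0 : ℝ) => a t

/-- The divergence theorem on the sphere. -/
theorem sphereIntegral_divergence (hm : 1 ≤ m) (hr : 0 < r) {X : Euc (m + 1) → Euc (m + 1)}
    (hX : SmoothOnSphere r X) (ht : ∀ x, ‖x‖ = r → ⟪x, X x⟫ = 0) :
    sphereIntegral r (divergence r X) = 0 := by
  -- The bump is supported in `[1, 3]`, and the cutoff below is `c y = χ(‖y‖²) ‖y‖`. The factor
  -- `‖y‖` compensates the homogeneity of degree `-1` of the derivative of the radial extension, so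
  -- that only `χ(t²)` is left as radial factor.
  let χ : ContDiffBump (2 : ℝ) := ⟨1 / 2, 1, by norm_num, by norm_num⟩
  have hχ0 : ∀ s : ℝ, s < 1 ∨ 3 < s → χ s = 0 := by
    intro s hs
    refine χ.zero_of_le_dist ?_
    rw [Real.dist_eq]
    rcases hs with hs | hs
    · rw [abs_of_neg (by linarith)]
      change 1 ≤ _
      linarith
    · rw [abs_of_pos (by linarith)]
      change 1 ≤ _
      linarith
  let φ : ℝ → ℝ := fun s => χ s * √s
  have hφ : ContDiff ℝ 1 φ := by
    rw [contDiff_iff_contDiffAt]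
    intro s
    by_cases hs : s = 0
    · have : φ =ᶠ[nhds s] fun _ => 0 := by
        filter_upwards [Iio_mem_nhds (show s < 1 by rw [hs]; norm_num)] with t ht
        simp [φ, hχ0 t (Or.inl ht)]
      exact contDiffAt_const.congr_of_eventuallyEq this
    · exact χ.contDiffAt.mul (Real.contDiffAt_sqrt hs)
  let c : Euc (m + 1) → ℝ := fun y => φ (‖y‖ ^ 2)
  have hc : ContDiff ℝ 1 c := hφ.comp (contDiff_norm_sq ℝ)
  let Y : Euc (m + 1) → Euc (m + 1) := fun y => c y • radialExt r X y
  have hc0 : ∀ y : Euc (m + 1), ‖y‖ < 1 ∨ 2 < ‖y‖ → c y = 0 := by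
    intro y hy
    have := norm_nonneg y
    have : χ (‖y‖ ^ 2) = 0 := hχ0 _ (by
      rcases hy with hy | hy
      · left; nlinarith
      · right; nlinarith)
    simp [c, φ, this]
  have hX1 : ∀ y, y ≠ 0 → ContDiffAt ℝ 1 (radialExt r X) y := fun y hy =>
    (hX.contDiffAt (isOpen_compl_singleton.mem_nhds hy)).of_le (by simp)
  have hY : ContDiff ℝ 1 Y := by
    rw [contDiff_iff_contDiffAt]
    intro y
    by_cases hy : y = 0
    · have : Y =ᶠ[nhds y] fun _ => 0 := by
        have hmem : {z : Euc (m + 1) | ‖z‖ < 1} ∈ nhds y :=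
          (isOpen_lt continuous_norm continuous_const).mem_nhds (by simp [hy])
        filter_upwards [hmem] with z hz
        simp [Y, hc0 z (Or.inl hz)]
      exact contDiffAt_const.congr_of_eventuallyEq this
    · exact hc.contDiffAt.smul (hX1 y hy)
  have hYc : HasCompactSupport Y := by
    refine HasCompactSupport.of_support_subset_isCompact
      (isCompact_closedBall (0 : Euc (m + 1)) 2) fun y hy => ?_
    by_contra h
    rw [mem_closedBall_zero_iff, not_le] at h
    exact hy (by simp [Y, hc0 y (Or.inr h)])
  have htr : ∀ y, y ≠ 0 → LinearMap.trace ℝ _ (fderiv ℝ Y y).toLinearMap =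
      c y * LinearMap.trace ℝ _ (fderiv ℝ (radialExt r X) y).toLinearMap := by
    intro y hy
    have hX' := (hX1 y hy).differentiableAt (by simp)
    have hort : ⟪y, radialExt r X y⟫ = 0 := by
      have h := ht _ (norm_normalize hr hy)
      rw [inner_smul_left] at h
      have h0 : r / ‖y‖ ≠ 0 := (div_pos hr (norm_pos_iff.2 hy)).ne'
      exact (mul_eq_zero.1 h).resolve_left (by simpa using h0)
    -- The cutoff is radial and the field tangential, so the cutoff contributes nothing to the
    -- divergence of `Y`.
    have hcd : fderiv ℝ c y (radialExt r X y) = 0 := by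
      have h1 :=
        ((hφ.differentiable (by simp)) (‖y‖ ^ 2)).hasDerivAt.comp_hasFDerivAt y
          (hasStrictFDerivAt_norm_sq y).hasFDerivAt
      have h2 := h1.fderiv
      change fderiv ℝ c y = _ at h2
      rw [h2]
      simp [hort]
    let b := EuclideanSpace.basisFun (Fin (m + 1)) ℝ
    have hexp : fderiv ℝ c y (radialExt r X y) =
        ∑ i, ⟪b i, radialExt r X y⟫ * fderiv ℝ c y (b i) := by
      nth_rewrite 1 [← b.sum_repr' (radialExt r X y)]
      simp
    rw [LinearMap.trace_eq_sum_inner _ b, LinearMap.trace_eq_sum_inner _ b, Finset.mul_sum,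
      ← add_zero (∑ i, c y * _), ← hcd, hexp, ← Finset.sum_add_distrib]
    refine Finset.sum_congr rfl fun i _ => ?_
    have : fderiv ℝ Y y = _ := fderiv_fun_smul (hc.differentiable (by simp) y) hX'
    rw [ContinuousLinearMap.coe_coe, this]
    simp [inner_add_right, inner_smul_right]
    ring
  have key : ∀ (y : Metric.sphere (0 : Euc (m + 1)) 1) (t : ℝ), 0 < t →
      LinearMap.trace ℝ _ (fderiv ℝ Y (t • (y : Euc (m + 1)))).toLinearMap =
        (r * divergence r X (r • (y : Euc (m + 1)))) * χ (t ^ 2) := by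
    intro y t ht0
    have hy1 : ‖(y : Euc (m + 1))‖ = 1 := norm_eq_of_mem_sphere y
    have hy0 : (y : Euc (m + 1)) ≠ 0 := by
      intro h
      simp [h] at hy1
    have hry : ‖r • (y : Euc (m + 1))‖ = r := by
      rw [norm_smul, hy1, Real.norm_of_nonneg hr.le, mul_one]
    have hD : fderiv ℝ (radialExt r X) (t • (y : Euc (m + 1))) =
        (r / t) • fderiv ℝ (radialExt r X) (r • (y : Euc (m + 1))) := by
      rw [fderiv_radialExt_smul X (div_pos hr ht0), smul_smul, div_mul_cancel₀ _ ht0.ne']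
    rw [htr _ (smul_ne_zero ht0.ne' hy0), hD, divergence_eq_trace hm hr hX hry]
    simp [c, φ, norm_smul, hy1, abs_of_pos ht0]
    field_simp
  have h0 := integral_trace_fderiv_eq_zero hY hYc
  rw [integral_mul_polar _ _ _ key] at h0
  -- The same polar formula, applied to `χ(‖y‖²)`, shows that the radial integral is nonzero; the
  -- angular integral must then vanish.
  have hpos : 0 < ∫ y : Euc (m + 1), χ (‖y‖ ^ 2) := by
    have hcont : Continuous fun y : Euc (m + 1) => χ (‖y‖ ^ 2) :=
      χ.continuous.comp (continuous_norm.pow 2)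
    refine hcont.integral_pos_of_hasCompactSupport_nonneg_nonzero ?_ (fun y => χ.nonneg)
      (x := √2 • EuclideanSpace.single 0 1) ?_
    · refine HasCompactSupport.of_support_subset_isCompact
        (isCompact_closedBall (0 : Euc (m + 1)) 2) fun y hy => ?_
      by_contra h
      rw [mem_closedBall_zero_iff, not_le] at h
      exact hy (hχ0 _ (Or.inr (by nlinarith)))
    · rw [norm_smul]
      simp only [PiLp.norm_single, norm_one, mul_one, Real.norm_eq_abs, sq_abs]
      rw [Real.sq_sqrt (by norm_num), χ.one_of_mem_closedBall]
      · norm_num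
      · exact Metric.mem_closedBall_self χ.rIn_pos.le
  rw [integral_mul_polar _ (fun t => χ (t ^ 2)) (fun _ => 1) (by
    intro y t ht0
    rw [norm_smul, norm_eq_of_mem_sphere y, Real.norm_of_nonneg ht0.le]
    simp)] at hpos
  have hne := right_ne_zero_of_mul hpos.ne'
  have h1 := (mul_eq_zero.1 h0).resolve_right hne
  rw [integral_const_mul] at h1
  rw [sphereIntegral, (mul_eq_zero.1 h1).resolve_left hr.ne', mul_zero]

end Divergence

/-! ### Elementary properties of the integral over the sphere -/

section Integral

variable {m : ℕ} {r : ℝ}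

/-- Continuity on the sphere of radius `r`, in terms of the unit sphere. -/
def ContinuousOnSphere (r : ℝ) (g : Euc (m + 1) → ℝ) : Prop :=
  Continuous fun y : Metric.sphere (0 : Euc (m + 1)) 1 => g (r • (y : Euc (m + 1)))

theorem norm_smul_unitSphere (hr : 0 < r) (y : Metric.sphere (0 : Euc (m + 1)) 1) :
    ‖r • (y : Euc (m + 1))‖ = r := by
  rw [norm_smul, norm_eq_of_mem_sphere y, Real.norm_of_nonneg hr.le, mul_one]

theorem ContinuousOnSphere.integrable {g : Euc (m + 1) → ℝ} (hg : ContinuousOnSphere r g) :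
    Integrable (fun y : Metric.sphere (0 : Euc (m + 1)) 1 => g (r • (y : Euc (m + 1))))
      (volume : Measure (Euc (m + 1))).toSphere :=
  Continuous.integrable_of_hasCompactSupport hg (HasCompactSupport.of_compactSpace _)

theorem ContinuousOnSphere.congr (hr : 0 < r) {f g : Euc (m + 1) → ℝ}
    (hf : ContinuousOnSphere r f) (h : ∀ x, ‖x‖ = r → g x = f x) : ContinuousOnSphere r g := by
  unfold ContinuousOnSphere at *
  refine hf.congr fun y => (h _ (norm_smul_unitSphere hr y)).symm

theorem ContinuousOnSphere.add {f g : Euc (m + 1) → ℝ} (hf : ContinuousOnSphere r f)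
    (hg : ContinuousOnSphere r g) : ContinuousOnSphere r fun x => f x + g x :=
  Continuous.add hf hg

theorem ContinuousOnSphere.sub {f g : Euc (m + 1) → ℝ} (hf : ContinuousOnSphere r f)
    (hg : ContinuousOnSphere r g) : ContinuousOnSphere r fun x => f x - g x :=
  Continuous.sub hf hg

theorem ContinuousOnSphere.mul {f g : Euc (m + 1) → ℝ} (hf : ContinuousOnSphere r f)
    (hg : ContinuousOnSphere r g) : ContinuousOnSphere r fun x => f x * g x :=
  Continuous.mul hf hg

theorem ContinuousOnSphere.pow {f : Euc (m + 1) → ℝ} (hf : ContinuousOnSphere r f) (n : ℕ) :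
    ContinuousOnSphere r fun x => f x ^ n :=
  Continuous.pow hf n

theorem continuousOnSphere_const (c : ℝ) :
    ContinuousOnSphere r fun _ : Euc (m + 1) => c :=
  continuous_const

theorem ContinuousOnSphere.sum {ι : Type*} {s : Finset ι} {g : ι → Euc (m + 1) → ℝ}
    (hg : ∀ i ∈ s, ContinuousOnSphere r (g i)) :
    ContinuousOnSphere r fun x => ∑ i ∈ s, g i x :=
  continuous_finsetSum s hg

theorem SmoothOnSphere.continuousOnSphere {g : Euc (m + 1) → ℝ} (hg : SmoothOnSphere r g) :
    ContinuousOnSphere r g :=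
  hg.continuous_unitSphere

theorem sphereIntegral_congr (hr : 0 < r) {f g : Euc (m + 1) → ℝ}
    (h : ∀ x, ‖x‖ = r → f x = g x) : sphereIntegral r f = sphereIntegral r g := by
  unfold sphereIntegral
  congr 2
  ext y
  exact h _ (norm_smul_unitSphere hr y)

theorem sphereIntegral_add {f g : Euc (m + 1) → ℝ} (hf : ContinuousOnSphere r f)
    (hg : ContinuousOnSphere r g) :
    sphereIntegral r (fun x => f x + g x) = sphereIntegral r f + sphereIntegral r g := by
  unfold sphereIntegral
  rw [integral_add hf.integrable hg.integrable, mul_add]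

theorem sphereIntegral_sub {f g : Euc (m + 1) → ℝ} (hf : ContinuousOnSphere r f)
    (hg : ContinuousOnSphere r g) :
    sphereIntegral r (fun x => f x - g x) = sphereIntegral r f - sphereIntegral r g := by
  unfold sphereIntegral
  rw [integral_sub hf.integrable hg.integrable, mul_sub]

theorem sphereIntegral_const_mul (c : ℝ) (g : Euc (m + 1) → ℝ) :
    sphereIntegral r (fun x => c * g x) = c * sphereIntegral r g := by
  unfold sphereIntegral
  rw [integral_const_mul]
  ring

theorem sphereIntegral_sum {ι : Type*} {s : Finset ι} {g : ι → Euc (m + 1) → ℝ}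
    (hg : ∀ i ∈ s, ContinuousOnSphere r (g i)) :
    sphereIntegral r (fun x => ∑ i ∈ s, g i x) = ∑ i ∈ s, sphereIntegral r (g i) := by
  unfold sphereIntegral
  rw [integral_finsetSum s fun i hi => (hg i hi).integrable, Finset.mul_sum]

theorem sphereIntegral_mono (hr : 0 < r) {f g : Euc (m + 1) → ℝ} (hf : ContinuousOnSphere r f)
    (hg : ContinuousOnSphere r g) (h : ∀ x, ‖x‖ = r → f x ≤ g x) :
    sphereIntegral r f ≤ sphereIntegral r g := by
  unfold sphereIntegral
  refine mul_le_mul_of_nonneg_left (integral_mono hf.integrable hg.integrable fun y => ?_)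
    (by positivity)
  exact h _ (norm_smul_unitSphere hr y)

theorem sphereIntegral_nonneg (hr : 0 < r) {g : Euc (m + 1) → ℝ}
    (h : ∀ x, ‖x‖ = r → 0 ≤ g x) : 0 ≤ sphereIntegral r g := by
  unfold sphereIntegral
  refine mul_nonneg (by positivity) (integral_nonneg fun y => ?_)
  exact h _ (norm_smul_unitSphere hr y)

theorem sphereIntegral_const_pos (hr : 0 < r) :
    0 < sphereIntegral r fun _ : Euc (m + 1) => (1 : ℝ) := by
  unfold sphereIntegral
  refine mul_pos (by positivity) ?_
  have : (volume : Measure (Euc (m + 1))).toSphere ≠ 0 := Measure.toSphere_ne_zero _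
  have : NeZero (volume : Measure (Euc (m + 1))).toSphere := ⟨this⟩
  rw [integral_const, smul_eq_mul, mul_one]
  exact measureReal_univ_pos

end Integral

/-! ### Green's formula and integration by parts for two-forms -/

section Green

variable {m : ℕ} {r : ℝ}

theorem SmoothOnSphere.continuousOnSphere_inner {X Y : Euc (m + 1) → Euc (m + 1)}
    (hX : SmoothOnSphere r X) (hY : SmoothOnSphere r Y) :
    ContinuousOnSphere r fun x => ⟪X x, Y x⟫ :=
  hX.continuous_unitSphere.inner hY.continuous_unitSphere

theorem continuousOnSphere_divergence (hm : 1 ≤ m) (hr : 0 < r)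
    {X : Euc (m + 1) → Euc (m + 1)} (hX : SmoothOnSphere r X) :
    ContinuousOnSphere r (divergence r X) := by
  let b := EuclideanSpace.basisFun (Fin (m + 1)) ℝ
  have h1 : ContDiffOn ℝ (⊤ : ℕ∞) (fderiv ℝ (radialExt r X)) {0}ᶜ :=
    hX.fderiv_of_isOpen isOpen_compl_singleton (by simp)
  have h2 : SmoothOnSphere r (fderiv ℝ (radialExt r X)) := smoothOnSphere_of_contDiffOn hr h1
  have h3 : ContinuousOnSphere r
      fun x => ∑ i, ⟪b i, fderiv ℝ (radialExt r X) x (b i)⟫ :=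
    ContinuousOnSphere.sum fun i _ =>
      continuous_const.inner (h2.continuous_unitSphere.clm_apply continuous_const)
  refine h3.congr hr fun x hx => ?_
  rw [divergence_eq_trace hm hr hX hx, LinearMap.trace_eq_sum_inner _ b]
  simp

theorem divergence_smul (hm : 1 ≤ m) (hr : 0 < r) {f : Euc (m + 1) → ℝ}
    {X : Euc (m + 1) → Euc (m + 1)} (hf : SmoothOnSphere r f) (hX : SmoothOnSphere r X)
    {x : Euc (m + 1)} (hx : ‖x‖ = r) (ht : ⟪x, X x⟫ = 0) :
    divergence r (fun x => f x • X x) x = ⟪grad r f x, X x⟫ + f x * divergence r X x := by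
  have hx0 := ne_zero_of_norm_eq hr hx
  have h : fderiv ℝ (radialExt r fun x => f x • X x) x =
      radialExt r f x • fderiv ℝ (radialExt r X) x +
        (fderiv ℝ (radialExt r f) x).smulRight (radialExt r X x) :=
    fderiv_fun_smul (hf.differentiableAt hx0) (hX.differentiableAt hx0)
  have hexp := sum_inner_smul_directFrame hm hr hx (X x)
  rw [ht, zero_div, zero_smul, sub_zero] at hexp
  rw [divergence, h, inner_grad, radialExt_of_norm_eq hr _ hx, radialExt_of_norm_eq hr _ hx]
  have hD : fderiv ℝ (radialExt r f) x (X x) = ∑ i, ⟪directFrame r x i, X x⟫ *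
      fderiv ℝ (radialExt r f) x (directFrame r x i) := by
    rw [← congrArg (fderiv ℝ (radialExt r f) x) hexp]
    simp
  rw [hD, divergence, Finset.mul_sum, ← Finset.sum_add_distrib]
  refine Finset.sum_congr rfl fun i _ => ?_
  simp only [add_apply, smul_apply,
    ContinuousLinearMap.smulRight_apply, inner_add_left, inner_smul_left,
    conj_trivial]
  rw [real_inner_comm (X x)]
  ring

theorem SmoothOnSphere.smul {f : Euc (m + 1) → ℝ} {X : Euc (m + 1) → Euc (m + 1)}
    (hf : SmoothOnSphere r f) (hX : SmoothOnSphere r X) :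
    SmoothOnSphere r fun x => f x • X x :=
  ContDiffOn.smul hf hX

/-- Green's formula on the sphere. -/
theorem sphereIntegral_inner_grad (hm : 1 ≤ m) (hr : 0 < r) {f : Euc (m + 1) → ℝ}
    {X : Euc (m + 1) → Euc (m + 1)} (hf : SmoothOnSphere r f) (hX : SmoothOnSphere r X)
    (ht : ∀ x, ‖x‖ = r → ⟪x, X x⟫ = 0) :
    sphereIntegral r (fun x => ⟪grad r f x, X x⟫) =
      -sphereIntegral r (fun x => f x * divergence r X x) := by
  have h := sphereIntegral_divergence hm hr (hf.smul hX) fun x hx => by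
    rw [inner_smul_right, ht x hx, mul_zero]
  rw [sphereIntegral_congr hr fun x hx => divergence_smul hm hr hf hX hx (ht x hx),
    sphereIntegral_add ((smoothOnSphere_grad hr hf).continuousOnSphere_inner hX)
      (hf.continuousOnSphere.mul (continuousOnSphere_divergence hm hr hX))] at h
  linarith

/-- A continuous alternating `2`-form as a continuous bilinear form. -/
noncomputable def twoFormLI (E : Type*) [NormedAddCommGroup E] [NormedSpace ℝ E] :
    (E [⋀^Fin 2]→L[ℝ] ℝ) →ₗᵢ[ℝ] E →L[ℝ] E →L[ℝ] ℝ where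
  toFun ω := (ContinuousAlternatingMap.ofSubsingletonLIE
    (0 : Fin 1)).symm.toLinearIsometry.toContinuousLinearMap.comp ω.curryLeft
  map_add' _ _ := by ext; simp
  map_smul' _ _ := by ext; simp
  norm_map' ω := by
    simp only [LinearMap.coe_mk, AddHom.coe_mk]
    rw [LinearIsometry.norm_toContinuousLinearMap_comp, ContinuousAlternatingMap.norm_curryLeft]

theorem twoFormLI_apply {E : Type*} [NormedAddCommGroup E] [NormedSpace ℝ E]
    (ω : E [⋀^Fin 2]→L[ℝ] ℝ) (u v : E) : twoFormLI E ω u v = ω ![u, v] := by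
  simp only [twoFormLI, LinearIsometry.coe_mk, LinearMap.coe_mk, AddHom.coe_mk]
  change ω (Matrix.vecCons u fun _ => v) = _
  congr 1
  ext i
  fin_cases i <;> rfl

theorem contDiff_twoFormLI {E : Type*} [NormedAddCommGroup E] [NormedSpace ℝ E] :
    ContDiff ℝ (⊤ : ℕ∞) fun ω : E [⋀^Fin 2]→L[ℝ] ℝ => twoFormLI E ω := by
  fun_prop

theorem hasFDerivAt_twoFormLI {E : Type*} [NormedAddCommGroup E] [NormedSpace ℝ E]
    (ω : E [⋀^Fin 2]→L[ℝ] ℝ) :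
    HasFDerivAt (fun ω : E [⋀^Fin 2]→L[ℝ] ℝ => twoFormLI E ω)
      (twoFormLI E).toContinuousLinearMap ω := by
  have := ContinuousLinearMap.hasFDerivAt (𝕜 := ℝ) (E := E [⋀^Fin 2]→L[ℝ] ℝ)
    (F := E →L[ℝ] E →L[ℝ] ℝ) (twoFormLI E).toContinuousLinearMap (x := ω)
  exact this

theorem contDiff_flip {E : Type*} [NormedAddCommGroup E] [NormedSpace ℝ E] :
    ContDiff ℝ (⊤ : ℕ∞) fun B : E →L[ℝ] E →L[ℝ] ℝ => B.flip := by
  have := LinearIsometryEquiv.contDiff (𝕜 := ℝ) (n := (⊤ : ℕ∞)) (E := E →L[ℝ] E →L[ℝ] ℝ)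
    (F := E →L[ℝ] E →L[ℝ] ℝ) (ContinuousLinearMap.flipₗᵢ ℝ E E ℝ)
  exact this

theorem twoFormLI_swap {E : Type*} [NormedAddCommGroup E] [NormedSpace ℝ E]
    (ω : E [⋀^Fin 2]→L[ℝ] ℝ) (u v : E) : twoFormLI E ω u v = -twoFormLI E ω v u := by
  rw [twoFormLI_apply, twoFormLI_apply]
  have := ω.toAlternatingMap.map_swap ![v, u] (show (0 : Fin 2) ≠ 1 by decide)
  convert! this using 2
  ext i
  fin_cases i <;> simp

/-- The vector field dual to the contraction `ω(·, G)`. -/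
noncomputable def contraction (ω : Euc (m + 1) → Euc (m + 1) [⋀^Fin 2]→L[ℝ] ℝ)
    (G : Euc (m + 1) → Euc (m + 1)) (x : Euc (m + 1)) : Euc (m + 1) :=
  (InnerProductSpace.toDual ℝ (Euc (m + 1))).symm ((twoFormLI _ (ω x)).flip (G x))

theorem inner_contraction (ω : Euc (m + 1) → Euc (m + 1) [⋀^Fin 2]→L[ℝ] ℝ)
    (G : Euc (m + 1) → Euc (m + 1)) (x u : Euc (m + 1)) :
    ⟪contraction ω G x, u⟫ = twoFormLI _ (ω x) u (G x) := by
  simp [contraction]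

theorem smoothOnSphere_contraction {ω : Euc (m + 1) → Euc (m + 1) [⋀^Fin 2]→L[ℝ] ℝ}
    {G : Euc (m + 1) → Euc (m + 1)} (hω : SmoothOnSphere r ω) (hG : SmoothOnSphere r G) :
    SmoothOnSphere r (contraction ω G) := by
  have h1 : ContDiffOn ℝ (⊤ : ℕ∞)
      (fun y => (twoFormLI _ (radialExt r ω y)).flip) {0}ᶜ :=
    contDiff_flip.comp_contDiffOn (contDiff_twoFormLI.comp_contDiffOn hω)
  exact (InnerProductSpace.toDual ℝ (Euc (m + 1))).symm.contDiff.comp_contDiffOn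
    (h1.clm_apply hG)

theorem inner_fderiv_gradient_comm {F : Euc (m + 1) → ℝ} (hF : ContDiffOn ℝ (⊤ : ℕ∞) F {0}ᶜ)
    {x : Euc (m + 1)} (hx : x ≠ 0) (u v : Euc (m + 1)) :
    ⟪fderiv ℝ (gradient F) x u, v⟫ = ⟪fderiv ℝ (gradient F) x v, u⟫ := by
  have hnhds := isOpen_compl_singleton.mem_nhds (show x ∈ ({0}ᶜ : Set (Euc (m + 1))) from hx)
  have h2 : DifferentiableAt ℝ (gradient F) x :=
    ((contDiffOn_gradient hF).contDiffAt hnhds).differentiableAt (by simp)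
  have h1 : DifferentiableAt ℝ (fderiv ℝ F) x :=
    ((hF.fderiv_of_isOpen isOpen_compl_singleton
      (m := (⊤ : ℕ∞)) (by simp)).contDiffAt hnhds).differentiableAt (by simp)
  have key : ∀ u v, ⟪fderiv ℝ (gradient F) x u, v⟫ = fderiv ℝ (fderiv ℝ F) x u v := by
    intro u v
    have h3 : (fun y => ⟪gradient F y, v⟫) = fun y => fderiv ℝ F y v := by
      ext y
      simp [gradient]
    have h4 : fderiv ℝ (fun y => ⟪gradient F y, v⟫) x u = ⟪fderiv ℝ (gradient F) x u, v⟫ := by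
      rw [fderiv_inner_apply ℝ h2 (by fun_prop)]
      simp
    rw [← h4, h3, fderiv_clm_apply h1 (by fun_prop)]
    simp
  rw [key, key]
  exact ((hF.contDiffAt hnhds).isSymmSndFDerivAt (by simp; norm_cast)) u v

/-- By the product rule the divergence is `∑ᵢ (∇_{eᵢ} ω)(eᵢ, ∇g) + ∑ᵢ ω(eᵢ, ∇_{eᵢ} ∇g)`. The second
sum pairs a symmetric with an antisymmetric array and vanishes. -/
theorem divergence_contraction (hm : 1 ≤ m) (hr : 0 < r)
    {ω : Euc (m + 1) → Euc (m + 1) [⋀^Fin 2]→L[ℝ] ℝ} (hω : IsTwoForm r ω)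
    {g : Euc (m + 1) → ℝ} (hg : SmoothOnSphere r g) {x : Euc (m + 1)} (hx : ‖x‖ = r) :
    divergence r (contraction ω (grad r g)) x = -codifferential r ω x (grad r g x) := by
  have hx0 := ne_zero_of_norm_eq hr hx
  have hG := smoothOnSphere_grad hr hg
  have hX := smoothOnSphere_contraction hω.smooth hG
  set A := fderiv ℝ (gradient (radialExt r g)) x with hA
  have hAd : DifferentiableAt ℝ (gradient (radialExt r g)) x :=
    ((contDiffOn_gradient hg).contDiffAt
      (isOpen_compl_singleton.mem_nhds hx0)).differentiableAt (by simp)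
  have he := directFrame_spec hm hr hx
  set e := directFrame r x
  have hterm : ∀ i, ⟪fderiv ℝ (radialExt r (contraction ω (grad r g))) x (e i), e i⟫ =
      fderiv ℝ (radialExt r ω) x (e i) ![e i, grad r g x] +
        ∑ j, ⟪A (e i), e j⟫ * twoFormLI _ (ω x) (e i) (e j) := by
    intro i
    have h1 : fderiv ℝ (fun y => ⟪radialExt r (contraction ω (grad r g)) y, e i⟫) x (e i) =
        ⟪fderiv ℝ (radialExt r (contraction ω (grad r g))) x (e i), e i⟫ := by
      rw [fderiv_inner_apply ℝ (hX.differentiableAt hx0) (by fun_prop)]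
      simp
    have h2 : (fun y => ⟪radialExt r (contraction ω (grad r g)) y, e i⟫) =
        fun y => twoFormLI _ (radialExt r ω y) (e i) (radialExt r (grad r g) y) := by
      ext y
      exact inner_contraction _ _ _ _
    have h3 : HasFDerivAt (fun y => twoFormLI _ (radialExt r ω y) (e i)) _ x :=
      ((hasFDerivAt_twoFormLI _).comp x (hω.smooth.differentiableAt hx0).hasFDerivAt).clm_apply (hasFDerivAt_const (e i) x)
    have h4 := (h3.clm_apply (hG.differentiableAt hx0).hasFDerivAt).fderiv
    -- `grad r g` is literally the gradient of the radial extension, defined off the sphere too.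
    -- Extending it again from the sphere leaves its derivative in the tangent direction `e i`
    -- unchanged.
    have h5 : fderiv ℝ (radialExt r (grad r g)) x (e i) = A (e i) := by
      have := fderiv_radialExt hr hx hAd (e i)
      rw [he.tangent i, zero_div, zero_smul, sub_zero] at this
      exact this
    have h6 : twoFormLI _ (ω x) (e i) (A (e i)) =
        ∑ j, ⟪A (e i), e j⟫ * twoFormLI _ (ω x) (e i) (e j) := by
      -- `A (e i)` need not be tangent, but its normal part is invisible to `ω`.
      have hexp := sum_inner_smul_directFrame hm hr hx (A (e i))
      have hwx : twoFormLI _ (ω x) (e i) x = 0 := by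
        rw [twoFormLI_swap, twoFormLI_apply, hω.tangential x hx, neg_zero]
      have := congrArg (twoFormLI _ (ω x) (e i)) hexp
      rw [map_sub, map_smul, hwx, smul_zero, sub_zero, map_sum] at this
      rw [← this]
      refine Finset.sum_congr rfl fun j _ => ?_
      rw [map_smul, real_inner_comm, smul_eq_mul]
    rw [← h1, h2, h4, ← h6, ← h5]
    simp [radialExt_of_norm_eq hr _ hx, twoFormLI_apply, add_comm]
  have hsym : ∑ i, ∑ j, ⟪A (e i), e j⟫ * twoFormLI _ (ω x) (e i) (e j) = 0 := by
    have h1 : ∑ i, ∑ j, ⟪A (e i), e j⟫ * twoFormLI _ (ω x) (e i) (e j) =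
        -∑ i, ∑ j, ⟪A (e i), e j⟫ * twoFormLI _ (ω x) (e i) (e j) := by
      nth_rewrite 1 [Finset.sum_comm]
      simp only [← Finset.sum_neg_distrib]
      refine Finset.sum_congr rfl fun i _ => Finset.sum_congr rfl fun j _ => ?_
      rw [hA, inner_fderiv_gradient_comm hg hx0, twoFormLI_swap]
      ring
    linarith
  rw [divergence, Finset.sum_congr rfl fun i _ => hterm i, Finset.sum_add_distrib, hsym,
    codifferential, add_zero, neg_neg]

/-- Integration by parts for a `2`-form evaluated on two gradients. -/
theorem sphereIntegral_twoForm_grad (hm : 1 ≤ m) (hr : 0 < r)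
    {ω : Euc (m + 1) → Euc (m + 1) [⋀^Fin 2]→L[ℝ] ℝ} (hω : IsTwoForm r ω)
    {f g : Euc (m + 1) → ℝ} (hf : SmoothOnSphere r f) (hg : SmoothOnSphere r g) :
    sphereIntegral r (fun x => ω x ![grad r f x, grad r g x]) =
      sphereIntegral r (fun x => f x * codifferential r ω x (grad r g x)) := by
  have hX := smoothOnSphere_contraction hω.smooth (smoothOnSphere_grad hr hg)
  have h := sphereIntegral_inner_grad hm hr hf hX fun x hx => by
    rw [real_inner_comm, inner_contraction, twoFormLI_apply, hω.tangential x hx]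
  have h1 : sphereIntegral r (fun x => ω x ![grad r f x, grad r g x]) =
      sphereIntegral r (fun x => ⟪grad r f x, contraction ω (grad r g) x⟫) :=
    sphereIntegral_congr hr fun x _ => by
      rw [real_inner_comm, inner_contraction, twoFormLI_apply]
  have h2 : sphereIntegral r (fun x => f x * divergence r (contraction ω (grad r g)) x) =
      sphereIntegral r (fun x => (-1) * (f x * codifferential r ω x (grad r g x))) :=
    sphereIntegral_congr hr fun x hx => by
      rw [divergence_contraction hm hr hω hg hx]
      ring
  rw [h1, h, h2, sphereIntegral_const_mul]
  ring

end Green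

open MvPolynomial

/-! ### Homogeneous harmonic polynomials -/

section Polynomial

variable {d : ℕ}

/-- The polynomial function on `ℝᵈ`. -/
noncomputable def polyFun (p : MvPolynomial (Fin d) ℝ) (x : Euc d) : ℝ := eval x.ofLp p

theorem contDiff_polyFun (p : MvPolynomial (Fin d) ℝ) : ContDiff ℝ (⊤ : ℕ∞) (polyFun p) := by
  induction p using MvPolynomial.induction_on with
  | C a =>
    have : polyFun (C a : MvPolynomial (Fin d) ℝ) = fun _ => a := by ext; simp [polyFun]
    rw [this]
    exact contDiff_const
  | add p q hp hq =>
    have h : polyFun (p + q) = fun y => polyFun p y + polyFun q y := by ext; simp [polyFun]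
    rw [h]
    exact hp.add hq
  | mul_X p i hp =>
    have hi : ContDiff ℝ (⊤ : ℕ∞) fun x : Euc d => x.ofLp i := by fun_prop
    have h : polyFun (p * X i) = fun y => polyFun p y * y.ofLp i := by ext; simp [polyFun]
    rw [h]
    exact hp.mul hi

theorem fderiv_polyFun (p : MvPolynomial (Fin d) ℝ) (x u : Euc d) :
    fderiv ℝ (polyFun p) x u = ∑ i, polyFun (pderiv i p) x * u.ofLp i := by
  induction p using MvPolynomial.induction_on with
  | C a =>
    have : polyFun (C a : MvPolynomial (Fin d) ℝ) = fun _ => a := by ext; simp [polyFun]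
    rw [this]
    simp [polyFun]
  | add p q hp hq =>
    have h : polyFun (p + q) = fun y => polyFun p y + polyFun q y := by ext; simp [polyFun]
    rw [h, fderiv_fun_add ((contDiff_polyFun p).differentiable (by simp) x)
      ((contDiff_polyFun q).differentiable (by simp) x), add_apply, hp, hq,
      ← Finset.sum_add_distrib]
    refine Finset.sum_congr rfl fun i _ => ?_
    simp [polyFun]
    ring
  | mul_X p i hp =>
    have h : polyFun (p * X i) = fun y => polyFun p y * y.ofLp i := by ext; simp [polyFun]
    have hi : HasFDerivAt (fun y : Euc d => y.ofLp i)
      (EuclideanSpace.proj i : Euc d →L[ℝ] ℝ) x :=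
      (EuclideanSpace.proj i : Euc d →L[ℝ] ℝ).hasFDerivAt
    have hm := (((contDiff_polyFun p).differentiable (by simp) x).hasFDerivAt.mul hi).fderiv
    change fderiv ℝ (fun y => polyFun p y * y.ofLp i) x = _ at hm
    rw [h, hm]
    have hproj : (EuclideanSpace.proj i : Euc d →L[ℝ] ℝ) u = u.ofLp i := rfl
    simp only [add_apply, smul_apply, hp, smul_eq_mul, hproj]
    have hterm : ∀ j, polyFun (pderiv j (p * X i)) x * u.ofLp j =
        x.ofLp i * (polyFun (pderiv j p) x * u.ofLp j) +
          if j = i then polyFun p x * u.ofLp i else 0 := by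
      intro j
      by_cases hj : j = i
      · subst hj
        simp [polyFun]
        ring
      · simp [polyFun, pderiv_X_of_ne (Ne.symm hj), hj]
        ring
    simp only [hterm, Finset.sum_add_distrib, ← Finset.mul_sum, Finset.sum_ite_eq',
      Finset.mem_univ, if_true]
    ring

/-- The polynomial vector field with components `Q`. -/
noncomputable def polyField (Q : Fin d → MvPolynomial (Fin d) ℝ) (x : Euc d) : Euc d :=
  WithLp.toLp 2 fun j => polyFun (Q j) x

theorem contDiff_polyField (Q : Fin d → MvPolynomial (Fin d) ℝ) :
    ContDiff ℝ (⊤ : ℕ∞) (polyField Q) :=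
  contDiff_euclidean.2 fun j => contDiff_polyFun (Q j)

theorem fderiv_polyField (Q : Fin d → MvPolynomial (Fin d) ℝ) (x u : Euc d) (j : Fin d) :
    (fderiv ℝ (polyField Q) x u).ofLp j = ∑ i, polyFun (pderiv i (Q j)) x * u.ofLp i := by
  have h := ((contDiff_polyField Q).differentiable (by simp) x).hasFDerivAt
  have hj : HasFDerivAt (fun y => (polyField Q y).ofLp j) _ x :=
    (EuclideanSpace.proj j : Euc d →L[ℝ] ℝ).hasFDerivAt.comp x h
  have := hj.fderiv
  rw [← fderiv_polyFun]
  change fderiv ℝ (polyFun (Q j)) x = _ at this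
  rw [this]
  rfl

theorem trace_fderiv_polyField (Q : Fin d → MvPolynomial (Fin d) ℝ) (x : Euc d) :
    LinearMap.trace ℝ _ (fderiv ℝ (polyField Q) x).toLinearMap =
      polyFun (∑ j, pderiv j (Q j)) x := by
  rw [LinearMap.trace_eq_sum_inner _ (EuclideanSpace.basisFun (Fin d) ℝ)]
  have : polyFun (∑ j, pderiv j (Q j)) x = ∑ j, polyFun (pderiv j (Q j)) x := by
    simp [polyFun]
  rw [this]
  refine Finset.sum_congr rfl fun j _ => ?_
  rw [ContinuousLinearMap.coe_coe, EuclideanSpace.basisFun_apply,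
    EuclideanSpace.inner_single_left, fderiv_polyField]
  simp [Finset.sum_ite_eq']

theorem inner_fderiv_polyField_self (Q : Fin d → MvPolynomial (Fin d) ℝ) (x : Euc d) :
    ⟪fderiv ℝ (polyField Q) x x, x⟫ =
      polyFun (∑ j, X j * ∑ i, X i * pderiv i (Q j)) x := by
  rw [PiLp.inner_apply]
  simp only [fderiv_polyField, polyFun, map_sum, map_mul, eval_X]
  refine Finset.sum_congr rfl fun j _ => ?_
  simp [mul_comm]

/-- The Laplacian of a polynomial. -/
noncomputable def polyLaplacian : MvPolynomial (Fin d) ℝ →ₗ[ℝ] MvPolynomial (Fin d) ℝ :=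
  ∑ i, (pderiv i).toLinearMap ∘ₗ (pderiv i).toLinearMap

theorem polyLaplacian_apply (p : MvPolynomial (Fin d) ℝ) :
    polyLaplacian p = ∑ i, pderiv i (pderiv i p) := by
  simp [polyLaplacian]

/-- The homogeneous harmonic polynomials of degree `k`. -/
noncomputable def harmonic (d k : ℕ) : Submodule ℝ (MvPolynomial (Fin d) ℝ) :=
  homogeneousSubmodule (Fin d) ℝ k ⊓ LinearMap.ker polyLaplacian

theorem mem_harmonic {k : ℕ} {p : MvPolynomial (Fin d) ℝ} :
    p ∈ harmonic d k ↔ p.IsHomogeneous k ∧ polyLaplacian p = 0 := by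
  simp [harmonic]

theorem polyLaplacian_mul (p q : MvPolynomial (Fin d) ℝ) :
    polyLaplacian (p * q) =
      p * polyLaplacian q + 2 * ∑ i, pderiv i p * pderiv i q + q * polyLaplacian p := by
  simp only [polyLaplacian_apply, Finset.mul_sum, ← Finset.sum_add_distrib]
  refine Finset.sum_congr rfl fun i _ => ?_
  simp only [Derivation.leibniz, map_add, smul_eq_mul]
  ring

/-- The commutator of two derivations is a derivation, and this one kills every variable. -/
theorem pderiv_pderiv_comm (i j : Fin d) (p : MvPolynomial (Fin d) ℝ) :
    pderiv i (pderiv j p) = pderiv j (pderiv i p) := by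
  have h : ⁅(pderiv i : Derivation ℝ (MvPolynomial (Fin d) ℝ) (MvPolynomial (Fin d) ℝ)),
      (pderiv j : Derivation ℝ (MvPolynomial (Fin d) ℝ) (MvPolynomial (Fin d) ℝ))⁆ = 0 := by
    refine derivation_ext fun k => ?_
    rw [Derivation.commutator_apply, pderiv_X, pderiv_X]
    simp [Pi.single_apply, apply_ite]
  have := congrArg (fun D => D p) h
  rw [Derivation.commutator_apply] at this
  exact sub_eq_zero.1 this

theorem pderiv_mem_harmonic {k : ℕ} {p : MvPolynomial (Fin d) ℝ} (hp : p ∈ harmonic d k)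
    (i : Fin d) : pderiv i p ∈ harmonic d (k - 1) := by
  rw [mem_harmonic] at hp ⊢
  refine ⟨hp.1.pderiv, ?_⟩
  rw [polyLaplacian_apply]
  have h : ∀ j, pderiv j (pderiv j (pderiv i p)) = pderiv i (pderiv j (pderiv j p)) := by
    intro j
    rw [pderiv_pderiv_comm j i p, pderiv_pderiv_comm j i]
  rw [Finset.sum_congr rfl fun j _ => h j, ← map_sum, ← polyLaplacian_apply, hp.2, map_zero]

/-- The polynomial `|x|²`. -/
noncomputable def normSqPoly (d : ℕ) : MvPolynomial (Fin d) ℝ := ∑ i, X i ^ 2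

theorem pderiv_normSqPoly (i : Fin d) : pderiv i (normSqPoly d) = C 2 * X i := by
  have h2 : (C 2 : MvPolynomial (Fin d) ℝ) = 2 := map_ofNat C 2
  simp [normSqPoly, pderiv_X, Pi.single_apply, h2]

theorem polyLaplacian_normSqPoly : polyLaplacian (normSqPoly d) = C (2 * d : ℝ) := by
  simp [polyLaplacian_apply, pderiv_normSqPoly, mul_comm]

theorem polyLaplacian_X (i : Fin d) : polyLaplacian (X i : MvPolynomial (Fin d) ℝ) = 0 := by
  simp [polyLaplacian_apply, pderiv_X, Pi.single_apply, apply_ite]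

theorem isHomogeneous_normSqPoly : (normSqPoly d).IsHomogeneous 2 :=
  IsHomogeneous.sum _ _ _ fun i _ => by simpa using (isHomogeneous_X ℝ i).pow 2

theorem polyFun_normSqPoly (x : Euc d) : polyFun (normSqPoly d) x = ‖x‖ ^ 2 := by
  simp [polyFun, normSqPoly, EuclideanSpace.norm_sq_eq]

/-- Multiplication by a coordinate, up to a multiple of `|x|²` times a harmonic polynomial, maps
harmonic polynomials of degree `k` to harmonic polynomials of degree `k + 1`. -/
theorem X_mul_sub_mem_harmonic (hd : 2 ≤ d) {k : ℕ} {p : MvPolynomial (Fin d) ℝ}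
    (hp : p ∈ harmonic d k) (i : Fin d) :
    X i * p - C (1 / (d + 2 * k - 2 : ℝ)) * (normSqPoly d * pderiv i p) ∈ harmonic d (k + 1) := by
  rw [mem_harmonic] at hp ⊢
  -- Degree zero is separate: the denominator `d + 2k - 2` vanishes there when `d = 2`, and `k - 1`
  -- is truncated. The correction term is zero since `p` is constant.
  rcases Nat.eq_zero_or_pos k with rfl | hk
  · have h0 : pderiv i p = 0 := by
      rw [← totalDegree_zero_iff_isHomogeneous, totalDegree_eq_zero_iff_eq_C] at hp
      rw [hp.1, pderiv_C]
    rw [h0, mul_zero, mul_zero, sub_zero]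
    refine ⟨by simpa [add_comm] using (isHomogeneous_X ℝ i).mul hp.1, ?_⟩
    rw [polyLaplacian_mul, hp.2, polyLaplacian_X]
    simp [pderiv_X, Pi.single_apply, h0]
  · have hq := mem_harmonic.1 (pderiv_mem_harmonic (mem_harmonic.2 hp) i)
    constructor
    · have h1 : (X i * p).IsHomogeneous (k + 1) := by
        simpa [add_comm] using (isHomogeneous_X ℝ i).mul hp.1
      have h2 : (normSqPoly d * pderiv i p).IsHomogeneous (k + 1) := by
        have := isHomogeneous_normSqPoly.mul hq.1
        rwa [show 2 + (k - 1) = k + 1 by omega] at this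
      have h3 := (isHomogeneous_C (Fin d) (1 / (d + 2 * k - 2 : ℝ))).mul h2
      rw [zero_add] at h3
      exact h1.sub h3
    · have hc : ∀ (a : ℝ) (q : MvPolynomial (Fin d) ℝ),
          polyLaplacian (C a * q) = C a * polyLaplacian q := by
        intro a q
        rw [← smul_eq_C_mul, map_smul, smul_eq_C_mul]
      have h1 : polyLaplacian (X i * p) = 2 * pderiv i p := by
        rw [polyLaplacian_mul, hp.2, polyLaplacian_X]
        simp [pderiv_X, Pi.single_apply]
      -- By Euler, `Δ(|x|² q) = (2d + 4 deg q) q` for harmonic homogeneous `q`, here with `deg q = k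
      -- - 1`. Comparison with `Δ(xᵢ p) = 2 ∂ᵢp` fixes the coefficient.
      have h2 : polyLaplacian (normSqPoly d * pderiv i p) =
          C (2 * (d + 2 * k - 2 : ℝ)) * pderiv i p := by
        have heuler := hq.1.sum_X_mul_pderiv
        have : ∑ j, pderiv j (normSqPoly d) * pderiv j (pderiv i p) =
            C 2 * ((k - 1) • pderiv i p) := by
          rw [← heuler, Finset.mul_sum]
          refine Finset.sum_congr rfl fun j _ => ?_
          rw [pderiv_normSqPoly]
          ring
        rw [polyLaplacian_mul, hq.2, this, polyLaplacian_normSqPoly, nsmul_eq_mul,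
          Nat.cast_sub hk]
        simp only [map_mul, map_add, map_sub, map_natCast, map_ofNat]
        push_cast
        ring
      have hne : (d + 2 * k - 2 : ℝ) ≠ 0 := by
        have h2d : (2 : ℝ) ≤ d := by exact_mod_cast hd
        have h1k : (1 : ℝ) ≤ k := by exact_mod_cast hk
        linarith
      rw [map_sub, hc, h1, h2, ← mul_assoc, ← map_mul,
        show 1 / (d + 2 * k - 2 : ℝ) * (2 * (d + 2 * k - 2)) = 2 by field_simp, map_ofNat, sub_self]

end Polynomial

/-! ### Harmonic polynomials as eigenfunctions -/

section Eigenfunction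

variable {m : ℕ} {r : ℝ}

theorem divergence_congr (hr : 0 < r) {X Y : Euc (m + 1) → Euc (m + 1)}
    (h : ∀ x, ‖x‖ = r → X x = Y x) {x : Euc (m + 1)} (hx : ‖x‖ = r) :
    divergence r X x = divergence r Y x := by
  have : radialExt r X =ᶠ[nhds x] radialExt r Y := by
    filter_upwards [isOpen_compl_singleton.mem_nhds (ne_zero_of_norm_eq hr hx)] with y hy
    exact h _ (norm_normalize hr hy)
  unfold divergence
  rw [this.fderiv_eq]

/-- The full trace minus its normal entry. The field may be any ambient extension, so polynomial
fields can be differentiated directly. -/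
theorem divergence_of_contDiff (hm : 1 ≤ m) (hr : 0 < r) {X : Euc (m + 1) → Euc (m + 1)}
    {x : Euc (m + 1)} (hX : DifferentiableAt ℝ X x) (hx : ‖x‖ = r) :
    divergence r X x =
      LinearMap.trace ℝ _ (fderiv ℝ X x).toLinearMap - ⟪fderiv ℝ X x x, x⟫ / r ^ 2 := by
  have h := sum_inner_directFrame hm hr hx (fderiv ℝ X x).toLinearMap
  simp only [ContinuousLinearMap.coe_coe] at h
  rw [← h, divergence]
  refine Finset.sum_congr rfl fun i _ => ?_
  rw [fderiv_radialExt hr hx hX, (directFrame_spec hm hr hx).tangent i]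
  simp

theorem smoothOnSphere_polyFun (hr : 0 < r) (p : MvPolynomial (Fin (m + 1)) ℝ) :
    SmoothOnSphere r (polyFun p) :=
  smoothOnSphere_of_contDiffOn hr (contDiff_polyFun p).contDiffOn

theorem sum_coord_mul_pderiv {k : ℕ} {p : MvPolynomial (Fin (m + 1)) ℝ}
    (hp : p.IsHomogeneous k) (x : Euc (m + 1)) :
    ∑ i, polyFun (pderiv i p) x * x.ofLp i = k * polyFun p x := by
  have := congrArg (fun q => polyFun q x) hp.sum_X_mul_pderiv
  simp only [polyFun, map_sum, map_mul, eval_X, map_natCast, nsmul_eq_mul] at this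
  rw [polyFun, ← this]
  exact Finset.sum_congr rfl fun i _ => mul_comm _ _

/-- The tangential part of the ambient gradient; by Euler its normal part is `(k / r²) p x`. The
result is again a polynomial field. -/
theorem grad_polyFun (hr : 0 < r) {k : ℕ} {p : MvPolynomial (Fin (m + 1)) ℝ}
    (hp : p.IsHomogeneous k) {x : Euc (m + 1)} (hx : ‖x‖ = r) :
    grad r (polyFun p) x = polyField (fun j => pderiv j p - C (k / r ^ 2) * (X j * p)) x := by
  refine ext_inner_right ℝ fun u => ?_
  rw [inner_grad, fderiv_radialExt hr hx ((contDiff_polyFun p).differentiable (by simp) x),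
    map_sub, map_smul, fderiv_polyFun, fderiv_polyFun, sum_coord_mul_pderiv hp, PiLp.inner_apply,
    PiLp.inner_apply]
  simp only [polyField, polyFun, map_sub, map_mul, eval_C, eval_X, smul_eq_mul, Finset.sum_div,
    Finset.sum_mul, ← Finset.sum_sub_distrib]
  refine Finset.sum_congr rfl fun i _ => ?_
  simp
  ring

/-- Harmonic homogeneous polynomials of degree `k` restrict to eigenfunctions of the sphere. -/
theorem divergence_grad_polyFun (hm : 1 ≤ m) (hr : 0 < r) {k : ℕ}
    {p : MvPolynomial (Fin (m + 1)) ℝ} (hp : p ∈ harmonic (m + 1) k) {x : Euc (m + 1)}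
    (hx : ‖x‖ = r) : divergence r (grad r (polyFun p)) x = -(eigval m r k * polyFun p x) := by
  rw [mem_harmonic] at hp
  set a : ℝ := k / r ^ 2 with ha
  set Q : Fin (m + 1) → MvPolynomial (Fin (m + 1)) ℝ :=
    fun j => pderiv j p - C a * (X j * p) with hQ
  have heuler := hp.1.sum_X_mul_pderiv
  have h1 : ∑ j, pderiv j (Q j) = -(C (a * (k + m + 1)) * p) := by
    have : ∀ j, pderiv j (Q j) = pderiv j (pderiv j p) - C a * (X j * pderiv j p) - C a * p := by
      intro j
      simp [hQ, pderiv_X]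
      ring
    simp only [this, Finset.sum_sub_distrib, ← Finset.mul_sum, heuler]
    rw [← polyLaplacian_apply, hp.2]
    simp
    ring
  have h2 : ∑ j, X j * ∑ i, X i * pderiv i (Q j) =
      C (k * (k - 1) : ℝ) * p - C (a * (k + 1)) * (normSqPoly (m + 1) * p) := by
    have hj : ∀ j, X j * ∑ i, X i * pderiv i (Q j) =
        ((k - 1 : ℕ) : MvPolynomial (Fin (m + 1)) ℝ) * (X j * pderiv j p) -
          C (a * (k + 1)) * (X j ^ 2 * p) := by
      intro j
      have hXp : (X j * p).IsHomogeneous (k + 1) := by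
        simpa [add_comm] using (isHomogeneous_X ℝ j).mul hp.1
      have : ∑ i, X i * pderiv i (Q j) =
          (k - 1) • pderiv j p - C a * ((k + 1) • (X j * p)) := by
        rw [← (hp.1.pderiv (i := j)).sum_X_mul_pderiv, ← hXp.sum_X_mul_pderiv, Finset.mul_sum,
          ← Finset.sum_sub_distrib]
        refine Finset.sum_congr rfl fun i _ => ?_
        rw [hQ, map_sub, pderiv_C_mul]
        ring
      rw [this]
      simp
      ring
    have hk : ((k - 1 : ℕ) : MvPolynomial (Fin (m + 1)) ℝ) * (k : MvPolynomial (Fin (m + 1)) ℝ) =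
        C (k * (k - 1) : ℝ) := by
      rcases Nat.eq_zero_or_pos k with rfl | h
      · simp
      · rw [Nat.cast_sub h]
        simp
        ring
    simp only [hj, Finset.sum_sub_distrib, ← Finset.mul_sum, heuler, ← Finset.sum_mul]
    rw [nsmul_eq_mul, ← mul_assoc, hk, normSqPoly]
  rw [divergence_congr hr (fun y hy => grad_polyFun hr hp.1 hy) hx,
    divergence_of_contDiff hm hr ((contDiff_polyField _).differentiable (by simp) x) hx,
    trace_fderiv_polyField, inner_fderiv_polyField_self, h1, h2]
  -- At `‖x‖ = r` the trace gives `-k(k + m + 1) / r²` and the normal entry `-2k / r²`; their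
  -- difference is `-k(k + m - 1) / r²`.
  have hn := polyFun_normSqPoly x
  rw [hx] at hn
  simp only [polyFun, map_neg, map_sub, map_mul, eval_C] at hn ⊢
  rw [hn, eigval, ha]
  field_simp
  ring

theorem memEigenspace_polyFun (hm : 1 ≤ m) (hr : 0 < r) {k : ℕ}
    {p : MvPolynomial (Fin (m + 1)) ℝ} (hp : p ∈ harmonic (m + 1) k) :
    MemEigenspace r k (polyFun p) where
  smooth := smoothOnSphere_polyFun hr p
  eigen x hx := by rw [laplaceBeltrami, divergence_grad_polyFun hm hr hp hx, neg_neg]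

end Eigenfunction

/-! ### Density of sums of harmonic polynomials -/

section Density

variable {m : ℕ}

/-- The coordinate functions of the sphere of radius `r`, as functions on the unit sphere. -/
noncomputable def sphereCoord (r : ℝ) (i : Fin (m + 1)) :
    C(Metric.sphere (0 : Euc (m + 1)) 1, ℝ) where
  toFun y := r * (y : Euc (m + 1)).ofLp i
  continuous_toFun := by fun_prop

/-- Restriction of polynomials to the sphere of radius `r`. -/
noncomputable def polyRestrict (r : ℝ) :
    MvPolynomial (Fin (m + 1)) ℝ →ₐ[ℝ] C(Metric.sphere (0 : Euc (m + 1)) 1, ℝ) :=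
  aeval (sphereCoord r)

theorem polyRestrict_apply (r : ℝ) (p : MvPolynomial (Fin (m + 1)) ℝ)
    (y : Metric.sphere (0 : Euc (m + 1)) 1) :
    polyRestrict r p y = polyFun p (r • (y : Euc (m + 1))) := by
  induction p using MvPolynomial.induction_on with
  | C a => simp [polyRestrict, polyFun]
  | add p q hp hq => simp [hp, hq, polyFun]
  | mul_X p i hp =>
    have : polyRestrict r (X i) y = r * (y : Euc (m + 1)).ofLp i := by
      simp [polyRestrict, sphereCoord]
    rw [map_mul, ContinuousMap.mul_apply, hp, this]
    simp [polyFun]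

theorem polyRestrict_normSqPoly (r : ℝ) :
    polyRestrict (m := m) r (normSqPoly (m + 1)) = ContinuousMap.C (r ^ 2) := by
  ext y
  rw [polyRestrict_apply, polyFun_normSqPoly, norm_smul, norm_eq_of_mem_sphere]
  simp

/-- It suffices that the span of harmonic restrictions is stable under multiplication by
coordinates. On the sphere `|x|²` is the constant `r²`, so `xᵢ h` is a harmonic of degree `k + 1`
plus a multiple of the harmonic `∂ᵢh`. -/
theorem polyRestrict_mem_iSup_harmonic (hm : 1 ≤ m) (r : ℝ) (p : MvPolynomial (Fin (m + 1)) ℝ) :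
    polyRestrict r p ∈ ⨆ k, (harmonic (m + 1) k).map (polyRestrict r).toLinearMap := by
  induction p using MvPolynomial.induction_on with
  | C a =>
    refine Submodule.mem_iSup_of_mem 0 (Submodule.mem_map_of_mem (mem_harmonic.2 ⟨?_, ?_⟩))
    · exact isHomogeneous_C _ _
    · simp [polyLaplacian_apply]
  | add p q hp hq =>
    rw [map_add]
    exact Submodule.add_mem _ hp hq
  | mul_X p i hp =>
    rw [map_mul]
    generalize polyRestrict r p = g at hp
    refine Submodule.iSup_induction
      (motive := fun g => g * polyRestrict r (X i) ∈
        ⨆ k, (harmonic (m + 1) k).map (polyRestrict r).toLinearMap) _ hp ?_ ?_ ?_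
    · intro k g hg
      obtain ⟨h, hh, rfl⟩ := hg
      set c : ℝ := 1 / ((m + 1 : ℕ) + 2 * k - 2 : ℝ) with hc
      have h1 := X_mul_sub_mem_harmonic (by omega) hh i
      have h2 := pderiv_mem_harmonic hh i
      have h3 : (polyRestrict r).toLinearMap h * polyRestrict r (X i) =
          (polyRestrict r).toLinearMap (X i * h - C c * (normSqPoly (m + 1) * pderiv i h)) +
            (c * r ^ 2) • (polyRestrict r).toLinearMap (pderiv i h) := by
        ext y
        simp [polyRestrict_normSqPoly, polyRestrict_apply, polyFun]
        ring
      rw [h3]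
      exact Submodule.add_mem _ (Submodule.mem_iSup_of_mem _ (Submodule.mem_map_of_mem h1))
        (Submodule.smul_mem _ _ (Submodule.mem_iSup_of_mem _ (Submodule.mem_map_of_mem h2)))
    · simp
    · intro f g hf hg
      rw [add_mul]
      exact Submodule.add_mem _ hf hg

/-- Uniform approximation on the sphere by sums of harmonic polynomials. -/
theorem exists_harmonic_near (hm : 1 ≤ m) {r : ℝ} (hr : 0 < r) {f : Euc (m + 1) → ℝ}
    (hf : ContinuousOnSphere r f) {ε : ℝ} (hε : 0 < ε) :
    ∃ (s : Finset ℕ) (h : ℕ → MvPolynomial (Fin (m + 1)) ℝ), (∀ k, h k ∈ harmonic (m + 1) k) ∧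
      ∀ x, ‖x‖ = r → |∑ k ∈ s, polyFun (h k) x - f x| < ε := by
  have hsep : (polyRestrict (m := m) r).range.SeparatesPoints := by
    intro y z hyz
    have : ∃ i, (y : Euc (m + 1)).ofLp i ≠ (z : Euc (m + 1)).ofLp i := by
      by_contra! h
      exact hyz (Subtype.ext (PiLp.ext h))
    obtain ⟨i, hi⟩ := this
    refine ⟨_, ⟨polyRestrict r (X i), ⟨X i, rfl⟩, rfl⟩, ?_⟩
    change polyRestrict r (X i) y ≠ polyRestrict r (X i) z
    rw [polyRestrict_apply, polyRestrict_apply]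
    simpa [polyFun, hr.ne'] using hi
  obtain ⟨⟨g, ⟨p, hp⟩⟩, hg⟩ :=
    ContinuousMap.exists_mem_subalgebra_near_continuousMap_of_separatesPoints _ hsep
      ⟨_, hf⟩ ε hε
  have hmem := polyRestrict_mem_iSup_harmonic hm r p
  rw [Submodule.mem_iSup_iff_exists_finsupp] at hmem
  obtain ⟨F, hF, hsum⟩ := hmem
  choose h hh hhF using hF
  refine ⟨F.support, h, hh, fun x hx => ?_⟩
  let y : Metric.sphere (0 : Euc (m + 1)) 1 := ⟨r⁻¹ • x, by
    rw [mem_sphere_zero_iff_norm, norm_smul, hx, norm_inv, Real.norm_of_nonneg hr.le,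
      inv_mul_cancel₀ hr.ne']⟩
  have hy : r • (y : Euc (m + 1)) = x := by
    simp [y, smul_smul, hr.ne']
  have hgy := (ContinuousMap.norm_lt_iff _ hε).1 hg y
  have hval : g y = ∑ k ∈ F.support, polyFun (h k) x := by
    have h1 : g = ∑ k ∈ F.support, F k := hp.symm.trans hsum.symm
    rw [h1, ContinuousMap.sum_apply]
    refine Finset.sum_congr rfl fun k _ => ?_
    rw [← hhF k, ← hy]
    exact polyRestrict_apply r (h k) y
  rw [← hval]
  rw [← hy]
  exact hgy

end Density

/-! ### The Poincaré inequality -/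

section Poincare

variable {m : ℕ} {r : ℝ}

theorem eigval_strictMono (hm : 1 ≤ m) (hr : 0 < r) : StrictMono (eigval m r) := by
  intro j k hjk
  unfold eigval
  have h1 : (1 : ℝ) ≤ m := by exact_mod_cast hm
  have h2 : (j : ℝ) + 1 ≤ k := by exact_mod_cast hjk
  have h3 : (0 : ℝ) ≤ j := Nat.cast_nonneg j
  refine div_lt_div_of_pos_right ?_ (by positivity)
  nlinarith

theorem eigval_zero : eigval m r 0 = 0 := by simp [eigval]

theorem eigval_pos (hm : 1 ≤ m) (hr : 0 < r) {k : ℕ} (hk : 1 ≤ k) : 0 < eigval m r k := by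
  have := eigval_strictMono hm hr (show 0 < k by omega)
  rwa [eigval_zero] at this

theorem SmoothOnSphere.sub_const {f : Euc (m + 1) → ℝ} (hf : SmoothOnSphere r f) (c : ℝ) :
    SmoothOnSphere r fun x => f x - c :=
  ContDiffOn.sub hf contDiffOn_const

theorem grad_sub_const (f : Euc (m + 1) → ℝ) (c : ℝ) :
    grad r (fun x => f x - c) = grad r f := by
  ext1 x
  have : radialExt r (fun x => f x - c) = fun y => radialExt r f y - c := rfl
  simp [grad, gradient, this, fderiv_sub_const]

theorem sphereIntegral_inner_grad_harmonic (hm : 1 ≤ m) (hr : 0 < r) {k : ℕ}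
    {p : MvPolynomial (Fin (m + 1)) ℝ} (hp : p ∈ harmonic (m + 1) k) {u : Euc (m + 1) → ℝ}
    (hu : SmoothOnSphere r u) :
    sphereIntegral r (fun x => ⟪grad r u x, grad r (polyFun p) x⟫) =
      eigval m r k * sphereIntegral r (fun x => u x * polyFun p x) := by
  have hs := smoothOnSphere_polyFun hr p
  rw [sphereIntegral_inner_grad hm hr hu (smoothOnSphere_grad hr hs)
    fun x hx => inner_self_grad hr hs hx]
  have : sphereIntegral r (fun x => u x * divergence r (grad r (polyFun p)) x) =
      sphereIntegral r (fun x => -eigval m r k * (u x * polyFun p x)) :=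
    sphereIntegral_congr hr fun x hx => by
      rw [divergence_grad_polyFun hm hr hp hx]
      ring
  rw [this, sphereIntegral_const_mul]
  ring

/-- Green's formula evaluates `∫ ⟨∇p, ∇q⟩` with either eigenvalue, and the eigenvalues are distinct.
-/
theorem sphereIntegral_harmonic_mul_harmonic (hm : 1 ≤ m) (hr : 0 < r) {j k : ℕ} (hjk : j ≠ k)
    {p q : MvPolynomial (Fin (m + 1)) ℝ} (hp : p ∈ harmonic (m + 1) j)
    (hq : q ∈ harmonic (m + 1) k) :
    sphereIntegral r (fun x => polyFun p x * polyFun q x) = 0 := by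
  have h1 := sphereIntegral_inner_grad_harmonic hm hr hq (smoothOnSphere_polyFun hr p)
  have h2 := sphereIntegral_inner_grad_harmonic hm hr hp (smoothOnSphere_polyFun hr q)
  simp only [fun x => real_inner_comm (grad r (polyFun p) x) (grad r (polyFun q) x),
    fun x => mul_comm (polyFun q x) (polyFun p x)] at h2
  have h3 : (eigval m r k - eigval m r j) *
      sphereIntegral r (fun x => polyFun p x * polyFun q x) = 0 := by
    rw [sub_mul, ← h1, ← h2, sub_self]
  exact (mul_eq_zero.1 h3).resolve_left
    (sub_ne_zero.2 ((eigval_strictMono hm hr).injective.ne hjk.symm))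

theorem sphereIntegral_harmonic (hm : 1 ≤ m) (hr : 0 < r) {k : ℕ} (hk : 1 ≤ k)
    {p : MvPolynomial (Fin (m + 1)) ℝ} (hp : p ∈ harmonic (m + 1) k) :
    sphereIntegral r (polyFun p) = 0 := by
  have h1 : (1 : MvPolynomial (Fin (m + 1)) ℝ) ∈ harmonic (m + 1) 0 :=
    mem_harmonic.2 ⟨MvPolynomial.isHomogeneous_one _ _, by simp [polyLaplacian_apply]⟩
  have := sphereIntegral_harmonic_mul_harmonic hm hr (show (0 : ℕ) ≠ k by omega) h1 hp
  have h2 : ∀ x : Euc (m + 1), polyFun 1 x = 1 := fun x => by simp [polyFun]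
  simpa only [h2, one_mul] using this

theorem harmonic_zero_eq_const {p : MvPolynomial (Fin (m + 1)) ℝ}
    (hp : p ∈ harmonic (m + 1) 0) : ∃ a, ∀ x, polyFun p x = a := by
  have := (mem_harmonic.1 hp).1
  rw [← MvPolynomial.totalDegree_zero_iff_isHomogeneous,
    MvPolynomial.totalDegree_eq_zero_iff_eq_C] at this
  exact ⟨p.coeff 0, fun x => by rw [this]; simp [polyFun]⟩

/-- The Dirichlet energy dominates `λ_l` times the `L²`-norm, up to the uniform distance to a sum
of harmonic polynomials, for functions orthogonal to those of degree less than `l`. -/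
theorem eigval_mul_le_energy_add (hm : 1 ≤ m) (hr : 0 < r) {l : ℕ} (hl : 1 ≤ l)
    {f : Euc (m + 1) → ℝ} (hf : SmoothOnSphere r f)
    (ho : ∀ k < l, ∀ p ∈ harmonic (m + 1) k, sphereIntegral r (fun x => f x * polyFun p x) = 0)
    {s : Finset ℕ} {h : ℕ → MvPolynomial (Fin (m + 1)) ℝ}
    (hh : ∀ k, h k ∈ harmonic (m + 1) k) :
    eigval m r l * sphereIntegral r (fun x => f x ^ 2) ≤
      sphereIntegral r (fun x => ‖grad r f x‖ ^ 2) +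
        eigval m r l * sphereIntegral r (fun x => (∑ k ∈ s, polyFun (h k) x - f x) ^ 2) := by
  have hhs : ∀ k, SmoothOnSphere r (polyFun (h k)) := fun k => smoothOnSphere_polyFun hr _
  have hgs : ∀ k, SmoothOnSphere r (grad r (polyFun (h k))) :=
    fun k => smoothOnSphere_grad hr (hhs k)
  have hgf := smoothOnSphere_grad hr hf
  set L := eigval m r l with hL
  have hLpos : 0 < L := eigval_pos hm hr hl
  set s' := s.filter (l ≤ ·) with hs'
  have hpos : ∀ k ∈ s', 0 < eigval m r k := fun k hk =>
    eigval_pos hm hr (hl.trans (Finset.mem_filter.1 hk).2)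
  -- `G` is the gradient of the inverse of `-Δ` applied to the part `∑_{k ≥ l} h_k` of the
  -- approximating sum. Hence pairing `∇u` with `G` integrates `u` against that part.
  let G : Euc (m + 1) → Euc (m + 1) :=
    fun x => ∑ k ∈ s', (eigval m r k)⁻¹ • grad r (polyFun (h k)) x
  have hsumc : ∀ u : Euc (m + 1) → Euc (m + 1), SmoothOnSphere r u → ∀ k ∈ s',
      ContinuousOnSphere r fun x => (eigval m r k)⁻¹ * ⟪u x, grad r (polyFun (h k)) x⟫ :=
    fun u hu k _ => (continuousOnSphere_const _).mul (hu.continuousOnSphere_inner (hgs k))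
  have hG : ∀ u : Euc (m + 1) → ℝ, SmoothOnSphere r u →
      sphereIntegral r (fun x => ⟪grad r u x, G x⟫) =
        ∑ k ∈ s', sphereIntegral r (fun x => u x * polyFun (h k) x) := by
    intro u hu
    have : (fun x => ⟪grad r u x, G x⟫) =
        fun x => ∑ k ∈ s', (eigval m r k)⁻¹ * ⟪grad r u x, grad r (polyFun (h k)) x⟫ := by
      ext x
      simp [G, inner_sum, inner_smul_right]
    rw [this, sphereIntegral_sum (hsumc _ (smoothOnSphere_grad hr hu))]
    refine Finset.sum_congr rfl fun k hk => ?_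
    rw [sphereIntegral_const_mul, sphereIntegral_inner_grad_harmonic hm hr (hh k) hu, ← mul_assoc,
      inv_mul_cancel₀ (hpos k hk).ne', one_mul]
  have hGc : ∀ u : Euc (m + 1) → Euc (m + 1), SmoothOnSphere r u →
      ContinuousOnSphere r fun x => ⟪u x, G x⟫ := by
    intro u hu
    refine (ContinuousOnSphere.sum (hsumc u hu)).congr hr fun x _ => ?_
    simp [G, inner_sum, inner_smul_right]
  have hGG : (fun x => ⟪G x, G x⟫) =
      fun x => ∑ k ∈ s', (eigval m r k)⁻¹ * ⟪grad r (polyFun (h k)) x, G x⟫ := by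
    ext x
    change ⟪∑ k ∈ s', (eigval m r k)⁻¹ • grad r (polyFun (h k)) x, G x⟫ = _
    simp [sum_inner, inner_smul_left]
  have hGGt : ∀ k ∈ s', ContinuousOnSphere r
      fun x => (eigval m r k)⁻¹ * ⟪grad r (polyFun (h k)) x, G x⟫ :=
    fun k _ => (continuousOnSphere_const _).mul (hGc _ (hgs k))
  have hGGc : ContinuousOnSphere r fun x => ⟪G x, G x⟫ := by
    rw [hGG]
    exact ContinuousOnSphere.sum hGGt
  have hsq : ∀ k, 0 ≤ sphereIntegral r (fun x => polyFun (h k) x * polyFun (h k) x) :=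
    fun k => sphereIntegral_nonneg hr fun x _ => mul_self_nonneg _
  have hortho : ∀ t : Finset ℕ, ∀ k ∈ t,
      ∑ j ∈ t, sphereIntegral r (fun x => polyFun (h k) x * polyFun (h j) x) =
        sphereIntegral r (fun x => polyFun (h k) x * polyFun (h k) x) := by
    intro t k hk
    refine Finset.sum_eq_single_of_mem k hk fun j _ hj => ?_
    exact sphereIntegral_harmonic_mul_harmonic hm hr hj.symm (hh k) (hh j)
  have hpc : ContinuousOnSphere r fun x => ∑ k ∈ s, polyFun (h k) x :=
    ContinuousOnSphere.sum fun k _ => (hhs k).continuousOnSphere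
  -- Terms of degree below `l` vanish by orthogonality of `f`, so the whole sum may be used.
  have hfp : sphereIntegral r (fun x => f x * ∑ k ∈ s, polyFun (h k) x) =
      sphereIntegral r (fun x => ⟪grad r f x, G x⟫) := by
    rw [hG f hf]
    simp only [Finset.mul_sum]
    rw [sphereIntegral_sum fun k _ => hf.continuousOnSphere.mul (hhs k).continuousOnSphere, hs',
      Finset.sum_filter_of_ne]
    intro k _ hk
    by_contra hlt
    exact hk (ho k (not_le.1 hlt) _ (hh k))
  have hpp : sphereIntegral r (fun x => (∑ k ∈ s, polyFun (h k) x) ^ 2) =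
      ∑ k ∈ s, sphereIntegral r (fun x => polyFun (h k) x * polyFun (h k) x) := by
    simp only [sq, Finset.sum_mul_sum]
    rw [sphereIntegral_sum fun k _ => ContinuousOnSphere.sum fun j _ =>
      (hhs k).continuousOnSphere.mul (hhs j).continuousOnSphere]
    refine Finset.sum_congr rfl fun k hk => ?_
    rw [sphereIntegral_sum fun j _ => (hhs k).continuousOnSphere.mul (hhs j).continuousOnSphere,
      hortho s k hk]
  -- `∫ ‖G‖² = ∑_{k ≥ l} λ_k⁻¹ ∫ h_k²` by orthogonality, and `L ≤ λ_k` for these `k`.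
  have hGGle : L * sphereIntegral r (fun x => ⟪G x, G x⟫) ≤
      sphereIntegral r (fun x => (∑ k ∈ s, polyFun (h k) x) ^ 2) := by
    rw [hGG, sphereIntegral_sum hGGt, hpp, Finset.mul_sum]
    refine le_trans (Finset.sum_le_sum fun k hk => ?_)
      (Finset.sum_le_sum_of_subset_of_nonneg (Finset.filter_subset _ _) fun k _ _ => hsq k)
    rw [sphereIntegral_const_mul, hG _ (hhs k), hortho s' k hk, ← mul_assoc]
    refine mul_le_of_le_one_left (hsq k) ?_
    rw [← div_eq_mul_inv, div_le_one (hpos k hk)]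
    exact (eigval_strictMono hm hr).monotone (Finset.mem_filter.1 hk).2
  have hfc := hf.continuousOnSphere
  have hexp1 : sphereIntegral r (fun x => (∑ k ∈ s, polyFun (h k) x - f x) ^ 2) =
      sphereIntegral r (fun x => (∑ k ∈ s, polyFun (h k) x) ^ 2) -
        2 * sphereIntegral r (fun x => f x * ∑ k ∈ s, polyFun (h k) x) +
          sphereIntegral r (fun x => f x ^ 2) := by
    rw [← sphereIntegral_const_mul, ← sphereIntegral_sub (hpc.pow 2)
      ((continuousOnSphere_const 2).mul (hfc.mul hpc)), ← sphereIntegral_add _ (hfc.pow 2)]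
    · congr 1
      ext x
      ring
    · exact (hpc.pow 2).sub ((continuousOnSphere_const 2).mul (hfc.mul hpc))
  have hgg : ContinuousOnSphere r fun x => ‖grad r f x‖ ^ 2 :=
    (hgf.continuousOnSphere_inner hgf).congr hr fun x _ => (real_inner_self_eq_norm_sq _).symm
  have hexp2 : sphereIntegral r (fun x => ‖grad r f x - L • G x‖ ^ 2) =
      sphereIntegral r (fun x => ‖grad r f x‖ ^ 2) -
        2 * L * sphereIntegral r (fun x => ⟪grad r f x, G x⟫) +
          L ^ 2 * sphereIntegral r (fun x => ⟪G x, G x⟫) := by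
    rw [← sphereIntegral_const_mul, ← sphereIntegral_const_mul, ← sphereIntegral_sub hgg
      ((continuousOnSphere_const (2 * L)).mul (hGc _ hgf)),
      ← sphereIntegral_add _ ((continuousOnSphere_const (L ^ 2)).mul hGGc)]
    · congr 1
      ext x
      rw [norm_sub_sq_real, inner_smul_right, norm_smul, mul_pow, Real.norm_eq_abs, sq_abs,
        real_inner_self_eq_norm_sq]
      ring
    · exact hgg.sub ((continuousOnSphere_const (2 * L)).mul (hGc _ hgf))
  -- With `p = ∑ h_k`, expanding the square and using `hGGle` gives `0 ≤ ∫ ‖∇f‖² - 2L ∫ f p + L ∫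
  -- p²`, and the last two terms equal `L ∫ (p - f)² - L ∫ f²`.
  have h0 : 0 ≤ sphereIntegral r (fun x => ‖grad r f x - L • G x‖ ^ 2) :=
    sphereIntegral_nonneg hr fun x _ => by positivity
  rw [hexp2, ← hfp] at h0
  rw [hexp1]
  nlinarith [mul_le_mul_of_nonneg_left hGGle hLpos.le]

/-- The Poincaré inequality for a smooth function in `E⁺_{λ_l(r)}`. -/
theorem MemEplus.exists_poincare (hm : 1 ≤ m) (hr : 0 < r) {l : ℕ} (hl : 1 ≤ l)
    {f : Euc (m + 1) → ℝ} (hf : MemEplus r l f) :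
    ∃ c : ℝ, eigval m r l * sphereIntegral r (fun x => (f x - c) ^ 2) ≤
      sphereIntegral r (fun x => ‖grad r f x‖ ^ 2) := by
  have h1 : 0 < sphereIntegral r fun _ : Euc (m + 1) => (1 : ℝ) := sphereIntegral_const_pos hr
  -- Membership in `E⁺` does not include orthogonality to constants; subtracting the mean supplies
  -- it and keeps the other relations, since harmonics of positive degree have mean zero.
  set c := sphereIntegral r f / sphereIntegral r fun _ : Euc (m + 1) => (1 : ℝ) with hc
  refine ⟨c, ?_⟩
  have hfc := hf.smooth.continuousOnSphere
  have hs := hf.smooth.sub_const c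
  have hmean : sphereIntegral r (fun x => f x - c) = 0 := by
    have : sphereIntegral r (fun _ : Euc (m + 1) => c) =
        c * sphereIntegral r fun _ : Euc (m + 1) => (1 : ℝ) := by
      rw [← sphereIntegral_const_mul, mul_one]
    rw [sphereIntegral_sub hfc (continuousOnSphere_const c), this, hc, div_mul_cancel₀ _ h1.ne',
      sub_self]
  have ho : ∀ k < l, ∀ p ∈ harmonic (m + 1) k,
      sphereIntegral r (fun x => (f x - c) * polyFun p x) = 0 := by
    intro k hk p hp
    rcases Nat.eq_zero_or_pos k with rfl | hk0
    · obtain ⟨a, ha⟩ := harmonic_zero_eq_const hp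
      simp only [ha, fun x => mul_comm (f x - c) a, sphereIntegral_const_mul, hmean, mul_zero]
    · have hpc := (smoothOnSphere_polyFun hr p).continuousOnSphere
      simp only [sub_mul]
      rw [sphereIntegral_sub (hfc.mul hpc) ((continuousOnSphere_const c).mul hpc),
        hf.orthogonal k hk0 hk _ (memEigenspace_polyFun hm hr hp), sphereIntegral_const_mul,
        sphereIntegral_harmonic hm hr hk0 hp, mul_zero, sub_self]
  refine le_of_forall_pos_le_add fun δ hδ => ?_
  have hL := eigval_pos hm hr hl
  -- Chosen so that `λ_l ε²` times the area of the sphere is `δ`.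
  set ε := √(δ / (eigval m r l * sphereIntegral r fun _ : Euc (m + 1) => (1 : ℝ))) with hε
  have hε0 : 0 < ε := Real.sqrt_pos.2 (by positivity)
  have hε2 : ε ^ 2 = δ / (eigval m r l * sphereIntegral r fun _ : Euc (m + 1) => (1 : ℝ)) :=
    Real.sq_sqrt (by positivity)
  obtain ⟨s, h, hh, hnear⟩ := exists_harmonic_near hm hr hs.continuousOnSphere hε0
  have key := eigval_mul_le_energy_add hm hr hl hs ho (s := s) hh
  rw [grad_sub_const] at key
  refine key.trans (add_le_add_right ?_ _)
  have hpc : ContinuousOnSphere r fun x => ∑ k ∈ s, polyFun (h k) x :=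
    ContinuousOnSphere.sum fun k _ => (smoothOnSphere_polyFun hr _).continuousOnSphere
  have hle : sphereIntegral r (fun x => (∑ k ∈ s, polyFun (h k) x - (f x - c)) ^ 2) ≤
      sphereIntegral r fun _ : Euc (m + 1) => ε ^ 2 * 1 := by
    refine sphereIntegral_mono hr ((hpc.sub hs.continuousOnSphere).pow 2)
      (continuousOnSphere_const _) fun x hx => ?_
    rw [mul_one]
    exact sq_le_sq' (abs_lt.1 (hnear x hx)).1.le (abs_lt.1 (hnear x hx)).2.le
  rw [sphereIntegral_const_mul, hε2] at hle
  calc _ ≤ _ := mul_le_mul_of_nonneg_left hle hL.le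
    _ = δ := by field_simp

end Poincare

/-! ### The semicalibration bound for `xi` and `Theta` -/

section Comass

variable {m k : ℕ} {r : ℝ}

theorem orthonormal_fin_cons {E : Type*} [NormedAddCommGroup E] [InnerProductSpace ℝ E] {N : ℕ}
    {w : E} {e : Fin N → E} (hw : ‖w‖ = 1) (he : Orthonormal ℝ e) (h : ∀ i, ⟪w, e i⟫ = 0) :
    Orthonormal ℝ (Fin.cons w e : Fin (N + 1) → E) := by
  constructor
  · intro i
    refine Fin.cases ?_ (fun j => ?_) i
    · simpa using hw
    · simpa using he.1 j
  · intro i j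
    refine Fin.cases ?_ (fun i => ?_) i <;> refine Fin.cases ?_ (fun j => ?_) j
    · simp
    · intro _
      simpa using h j
    · intro _
      simpa [real_inner_comm] using h i
    · intro hij
      simpa using he.2 (fun h => hij (by rw [h]))

theorem orthonormal_update {E : Type*} [NormedAddCommGroup E] [InnerProductSpace ℝ E] {N : ℕ}
    {w : E} {e : Fin N → E} (hw : ‖w‖ = 1) (he : Orthonormal ℝ e) (h : ∀ i, ⟪w, e i⟫ = 0)
    (i₀ : Fin N) : Orthonormal ℝ (Function.update e i₀ w) := by
  constructor
  · intro i
    by_cases hi : i = i₀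
    · subst hi
      simpa using hw
    · simpa [hi] using he.1 i
  · intro i j hij
    by_cases hi : i = i₀
    · subst hi
      simpa [Ne.symm hij] using h j
    · by_cases hj : j = i₀
      · subst hj
        simpa [hi, real_inner_comm] using h i
      · simpa [hi, hj] using he.2 hij

/-- The value of an alternating form of top degree on two orthonormal bases agrees up to sign. -/
theorem abs_alternating_eq_of_orthonormalBasis {E : Type*} [NormedAddCommGroup E]
    [InnerProductSpace ℝ E] {N : ℕ} (μ : E [⋀^Fin N]→ₗ[ℝ] ℝ) (b b' : OrthonormalBasis (Fin N) ℝ E) :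
    |μ b| = |μ b'| := by
  have h := μ.eq_smul_basis_det b'.toBasis
  have h1 := congrArg (fun η => η b) h
  simp only [AlternatingMap.smul_apply, OrthonormalBasis.coe_toBasis, smul_eq_mul] at h1
  have h2 : b'.toBasis.det b = 1 ∨ b'.toBasis.det b = -1 :=
    b'.det_to_matrix_orthonormalBasis_real b
  rw [h1, abs_mul]
  rcases h2 with h2 | h2 <;> rw [h2] <;> simp

/-- The alternating form `u ↦ ∑ᵢ ⟨v, uᵢ⟩ Ω(W, φ u₁, …, W', …, φ uₘ)` with `W'` in the place of
`φ uᵢ`. -/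
noncomputable def xiForm (η : Euc k [⋀^Fin (m + 1)]→L[ℝ] ℝ) (φ : Euc (m + 1) →ₗᵢ[ℝ] Euc k)
    (W W' : Euc k) (v : Euc (m + 1)) : Euc (m + 1) [⋀^Fin m]→L[ℝ] ℝ :=
  (η.curryLeft W).fderivCompContinuousLinearMap φ.toContinuousLinearMap
    ((innerSL ℝ v).smulRight W')

/-- `xiForm` is the derivative of the pullback of `η(W, ·)` at `φ` in the direction `⟨v, ·⟩ W'`,
which makes it alternating without further work. -/
theorem xiForm_apply (η : Euc k [⋀^Fin (m + 1)]→L[ℝ] ℝ) (φ : Euc (m + 1) →ₗᵢ[ℝ] Euc k)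
    (W W' : Euc k) (v : Euc (m + 1)) (u : Fin m → Euc (m + 1)) :
    xiForm η φ W W' v u =
      ∑ i, η (Fin.cons W (Function.update (fun j => φ (u j)) i W')) * ⟪u i, v⟫ := by
  rw [xiForm, ContinuousAlternatingMap.fderivCompContinuousLinearMap_apply]
  refine Finset.sum_congr rfl fun i _ => ?_
  have h : (fun j => Function.update (fun _ : Fin m => φ.toContinuousLinearMap) i
      ((innerSL ℝ v).smulRight W') j (u j)) =
      Function.update (fun j => φ (u j)) i (⟪v, u i⟫ • W') := by
    ext1 j
    by_cases hj : j = i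
    · subst hj
      simp
    · simp [hj]
  rw [h, ContinuousAlternatingMap.map_update_smul, ContinuousAlternatingMap.curryLeft_apply_apply,
    smul_eq_mul, mul_comm, real_inner_comm]
  rfl

theorem xi_apply (Ω : Euc k → Euc k [⋀^Fin (m + 1)]→L[ℝ] ℝ) (φ : Euc (m + 1) →ₗᵢ[ℝ] Euc k)
    (W W' : Euc k) (x v : Euc (m + 1)) :
    xi Ω φ r W W' x v = xiForm (Ω (φ x)) φ W W' v (directFrame r x) := by
  rw [xiForm_apply, xi]
  simp

/-- For fixed `v` the value is an alternating form of top degree on the tangent space, so up to sign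
the frame may be replaced by one containing the normalized tangential part of `v`. One summand
survives, and it is `Ω` on an orthonormal system. -/
theorem abs_xi_le (hm : 1 ≤ m) (hr : 0 < r) {Ω : Euc k → Euc k [⋀^Fin (m + 1)]→L[ℝ] ℝ}
    (hΩ : IsSemicalibration Ω) (φ : Euc (m + 1) →ₗᵢ[ℝ] Euc k) {W W' : Euc k} (hW : ‖W‖ = 1)
    (hW' : ‖W'‖ = 1) (hWW' : ⟪W, W'⟫ = 0) (hWφ : ∀ y, ⟪W, φ y⟫ = 0) (hWφ' : ∀ y, ⟪W', φ y⟫ = 0)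
    {x : Euc (m + 1)} (hx : ‖x‖ = r) (v : Euc (m + 1)) : |xi Ω φ r W W' x v| ≤ ‖v‖ := by
  have he := directFrame_spec hm hr hx
  set e := directFrame r x with hedef
  let K : Submodule ℝ (Euc (m + 1)) := (ℝ ∙ x)ᗮ
  have hK : Module.finrank ℝ K = m := by
    have : Fact (Module.finrank ℝ (Euc (m + 1)) = m + 1) := ⟨by simp⟩
    exact Submodule.finrank_orthogonal_span_singleton (ne_zero_of_norm_eq hr hx)
  have heK : ∀ i, e i ∈ K := fun i =>
    Submodule.mem_orthogonal_singleton_iff_inner_right.2 (he.tangent i)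
  let eK : Fin m → K := fun i => ⟨e i, heK i⟩
  have heKo : Orthonormal ℝ eK := by
    constructor
    · exact fun i => he.orthonormal.1 i
    · exact fun i j hij => he.orthonormal.2 hij
  let b : OrthonormalBasis (Fin m) ℝ K := OrthonormalBasis.mk heKo
    (heKo.linearIndependent.span_eq_top_of_card_eq_finrank' (by simp [hK])).ge
  have hb : ∀ i, (b i : Euc (m + 1)) = e i := fun i => by simp [b, eK]
  let n : K := K.orthogonalProjectionOnto v
  have hxin : xi Ω φ r W W' x v = xi Ω φ r W W' x (n : Euc (m + 1)) := by
    rw [xi_apply, xi_apply, xiForm_apply, xiForm_apply]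
    refine Finset.sum_congr rfl fun i _ => ?_
    congr 1
    have := K.inner_orthogonalProjectionOnto_eq_of_mem_left ⟨e i, heK i⟩ v
    exact this.symm
  have hnv : ‖n‖ ≤ ‖v‖ := K.norm_orthogonalProjectionOnto_apply_le v
  rw [hxin]
  refine le_trans ?_ hnv
  by_cases hn : n = 0
  · simp [hn]
  let i₀ : Fin m := ⟨0, hm⟩
  let w : K := (‖n‖⁻¹ : ℝ) • n
  have hn0 : ‖n‖ ≠ 0 := norm_ne_zero_iff.2 hn
  have hw : ‖w‖ = 1 := by
    rw [norm_smul, norm_inv, norm_norm, inv_mul_cancel₀ hn0]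
  have hnw : (n : Euc (m + 1)) = ‖n‖ • (w : Euc (m + 1)) := by
    rw [← Submodule.coe_smul, smul_smul, mul_inv_cancel₀ hn0, one_smul]
  have hsub : Subsingleton ({i₀} : Set (Fin m)) := inferInstance
  -- The constant family `w` is prescribed only on the singleton `{i₀}`.
  obtain ⟨b', hb'⟩ := Orthonormal.exists_orthonormalBasis_extension_of_card_eq (𝕜 := ℝ)
    (by simp [hK]) (v := fun _ : Fin m => w) (s := {i₀})
    ⟨fun _ => hw, fun i j hij => (hij (Subsingleton.elim i j)).elim⟩
  have hb'0 : b' i₀ = w := hb' i₀ rfl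
  rw [hnw, map_smul, smul_eq_mul, abs_mul, abs_of_nonneg (norm_nonneg n)]
  refine mul_le_of_le_one_right (norm_nonneg n) ?_
  let μ : K [⋀^Fin m]→ₗ[ℝ] ℝ :=
    (xiForm (Ω (φ x)) φ W W' w).toAlternatingMap.compLinearMap K.subtype
  have hμ : ∀ c : OrthonormalBasis (Fin m) ℝ K,
      μ c = xiForm (Ω (φ x)) φ W W' w fun i => (c i : Euc (m + 1)) := fun c => rfl
  have hxi : xi Ω φ r W W' x w = μ b := by
    rw [xi_apply, hμ]
    simp only [hb]
    rfl
  have hbo : Orthonormal ℝ fun i => φ (b' i : Euc (m + 1)) :=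
    (b'.orthonormal.comp_linearIsometry K.subtypeₗᵢ).comp_linearIsometry φ
  have hval : μ b' = Ω (φ x)
      (Fin.cons W (Function.update (fun i => φ (b' i : Euc (m + 1))) i₀ W')) := by
    rw [hμ, xiForm_apply, Finset.sum_eq_single i₀]
    · have : ⟪(b' i₀ : Euc (m + 1)), (w : Euc (m + 1))⟫ = 1 := by
        rw [hb'0, real_inner_self_eq_norm_sq]
        change ‖w‖ ^ 2 = 1
        rw [hw, one_pow]
      rw [this, mul_one]
    · intro i _ hi
      have : ⟪(b' i : Euc (m + 1)), (w : Euc (m + 1))⟫ = 0 := by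
        rw [← hb'0]
        exact b'.orthonormal.2 hi
      rw [this, mul_zero]
    · simp
  rw [hxi, abs_alternating_eq_of_orthonormalBasis μ b b', hval]
  refine hΩ.le_one _ _ (orthonormal_fin_cons hW (orthonormal_update hW' hbo
    (fun i => hWφ' _) i₀) fun i => ?_)
  by_cases hi : i = i₀
  · subst hi
    simpa using hWW'
  · simpa [hi] using hWφ _

variable {N : ℕ}

theorem norm_xi_le_one (hm : 1 ≤ m) (hr : 0 < r) {Ω : Euc k → Euc k [⋀^Fin (m + 1)]→L[ℝ] ℝ}
    (hΩ : IsSemicalibration Ω) (φ : Euc (m + 1) →ₗᵢ[ℝ] Euc k) {W : Fin N → Euc k}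
    (hW : Orthonormal ℝ W) (hWφ : ∀ α y, ⟪W α, φ y⟫ = 0) {α β : Fin N} (h : α ≠ β)
    {x : Euc (m + 1)} (hx : ‖x‖ = r) : ‖xi Ω φ r (W α) (W β) x‖ ≤ 1 :=
  ContinuousLinearMap.opNorm_le_bound _ zero_le_one fun v => by
    rw [one_mul]
    exact abs_xi_le hm hr hΩ φ (hW.1 α) (hW.1 β) (hW.2 h) (hWφ α) (hWφ β) hx v

theorem Theta_nonneg (Ω : Euc k → Euc k [⋀^Fin (m + 1)]→L[ℝ] ℝ) (φ : Euc (m + 1) →ₗᵢ[ℝ] Euc k)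
    (r : ℝ) (W : Fin N → Euc k) : 0 ≤ Theta Ω φ r W :=
  Real.iSup_nonneg fun _ => Real.iSup_nonneg fun _ => norm_nonneg _

/-- With no pair `α < β` the real supremum is `0` by default, whence the extra use of `0 ≤ 1`. -/
theorem Theta_le_one (hm : 1 ≤ m) (hr : 0 < r) {Ω : Euc k → Euc k [⋀^Fin (m + 1)]→L[ℝ] ℝ}
    (hΩ : IsSemicalibration Ω) (φ : Euc (m + 1) →ₗᵢ[ℝ] Euc k) {W : Fin N → Euc k}
    (hW : Orthonormal ℝ W) (hWφ : ∀ α y, ⟪W α, φ y⟫ = 0) : Theta Ω φ r W ≤ 1 :=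
  Real.iSup_le (fun p => Real.iSup_le (fun x => norm_xi_le_one hm hr hΩ φ hW hWφ p.2.ne
    (norm_eq_of_mem_sphere x)) zero_le_one) zero_le_one

/-- A real supremum dominates its family only when that is bounded above; the uniform bound `1`
provides this at both levels. -/
theorem norm_xi_le_Theta (hm : 1 ≤ m) (hr : 0 < r) {Ω : Euc k → Euc k [⋀^Fin (m + 1)]→L[ℝ] ℝ}
    (hΩ : IsSemicalibration Ω) (φ : Euc (m + 1) →ₗᵢ[ℝ] Euc k) {W : Fin N → Euc k}
    (hW : Orthonormal ℝ W) (hWφ : ∀ α y, ⟪W α, φ y⟫ = 0) {α β : Fin N} (h : α < β)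
    {x : Euc (m + 1)} (hx : ‖x‖ = r) : ‖xi Ω φ r (W α) (W β) x‖ ≤ Theta Ω φ r W := by
  have h1 : ∀ p : {p : Fin N × Fin N // p.1 < p.2}, ∀ x : Metric.sphere (0 : Euc (m + 1)) r,
      ‖xi Ω φ r (W p.1.1) (W p.1.2) x‖ ≤ 1 :=
    fun p x => norm_xi_le_one hm hr hΩ φ hW hWφ p.2.ne (norm_eq_of_mem_sphere x)
  have hb1 : BddAbove (Set.range fun x : Metric.sphere (0 : Euc (m + 1)) r =>
      ‖xi Ω φ r (W α) (W β) x‖) :=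
    ⟨1, by rintro _ ⟨x, rfl⟩; exact h1 ⟨(α, β), h⟩ x⟩
  have hb2 : BddAbove (Set.range fun p : {p : Fin N × Fin N // p.1 < p.2} =>
      ⨆ x : Metric.sphere (0 : Euc (m + 1)) r, ‖xi Ω φ r (W p.1.1) (W p.1.2) x‖) :=
    ⟨1, by rintro _ ⟨p, rfl⟩; exact Real.iSup_le (h1 p) zero_le_one⟩
  exact (le_ciSup hb1 ⟨x, mem_sphere_zero_iff_norm.2 hx⟩).trans
    (le_ciSup hb2 ⟨(α, β), h⟩)

end Comass

/-! ### The estimate for a pair of functions -/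

section CauchyRiemann

variable {m N : ℕ} {r : ℝ}

theorem energy_nonneg (hr : 0 < r) (f : Fin N → Euc (m + 1) → ℝ) : 0 ≤ energy r f :=
  Finset.sum_nonneg fun _ _ => sphereIntegral_nonneg hr fun _ _ => by positivity

/-- Each index belongs to `N - 1` pairs: as the smaller one, or as the larger one. -/
theorem sum_Ioi_add (a : Fin N → ℝ) :
    ∑ α, ∑ β ∈ Finset.Ioi α, (a α + a β) = (N - 1) * ∑ α, a α := by
  have h1 : ∑ α, ∑ β ∈ Finset.Ioi α, a β = ∑ β, ∑ α ∈ Finset.Iio β, a β :=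
    Finset.sum_comm' (by simp)
  simp only [Finset.sum_add_distrib, h1, Finset.sum_const, Fin.card_Ioi, Fin.card_Iio]
  rw [← Finset.sum_add_distrib, Finset.mul_sum]
  refine Finset.sum_congr rfl fun α _ => ?_
  rw [← add_nsmul, nsmul_eq_mul]
  congr 1
  have : N - 1 - (α : ℕ) + α + 1 = N := by omega
  have h2 : (((N - 1 - (α : ℕ) + α + 1 : ℕ)) : ℝ) = N := by exact_mod_cast this
  push_cast at h2 ⊢
  linarith

theorem continuousOnSphere_codifferential_grad (hm : 1 ≤ m) (hr : 0 < r)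
    {ω : Euc (m + 1) → Euc (m + 1) [⋀^Fin 2]→L[ℝ] ℝ} (hω : IsTwoForm r ω)
    {g : Euc (m + 1) → ℝ} (hg : SmoothOnSphere r g) :
    ContinuousOnSphere r fun x => codifferential r ω x (grad r g x) := by
  have h := (continuousOnSphere_const (m := m) (-1)).mul (continuousOnSphere_divergence hm hr
    (smoothOnSphere_contraction hω.smooth (smoothOnSphere_grad hr hg)))
  refine h.congr hr fun x hx => ?_
  rw [divergence_contraction hm hr hω hg hx]
  ring

theorem SmoothOnSphere.continuousOnSphere_norm_grad_sq (hr : 0 < r) {g : Euc (m + 1) → ℝ}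
    (hg : SmoothOnSphere r g) : ContinuousOnSphere r fun x => ‖grad r g x‖ ^ 2 :=
  ((smoothOnSphere_grad hr hg).continuousOnSphere_inner (smoothOnSphere_grad hr hg)).congr hr
    fun _ _ => (real_inner_self_eq_norm_sq _).symm

/-- The long Cauchy–Riemann term of a pair of functions, when the codifferential of `ω` has norm at
most `Θ` and `f` satisfies a Poincaré inequality with constant `s ^ 2` after subtraction of `c`. -/
theorem neg_two_mul_sphereIntegral_twoForm_grad_le (hm : 1 ≤ m) (hr : 0 < r)
    {ω : Euc (m + 1) → Euc (m + 1) [⋀^Fin 2]→L[ℝ] ℝ} (hω : IsTwoForm r ω)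
    {Θ : ℝ} (hΘ : 0 ≤ Θ)
    (hδ : ∀ x v : Euc (m + 1), ‖x‖ = r → ⟪x, v⟫ = 0 → |codifferential r ω x v| ≤ Θ * ‖v‖)
    {f g : Euc (m + 1) → ℝ} (hf : SmoothOnSphere r f) (hg : SmoothOnSphere r g) {s c : ℝ}
    (hs : 0 < s) (hc : s ^ 2 * sphereIntegral r (fun x => (f x - c) ^ 2) ≤
      sphereIntegral r (fun x => ‖grad r f x‖ ^ 2)) :
    -2 * sphereIntegral r (fun x => ω x ![grad r f x, grad r g x]) ≤
      Θ / s * (sphereIntegral r (fun x => ‖grad r f x‖ ^ 2) +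
        sphereIntegral r (fun x => ‖grad r g x‖ ^ 2)) := by
  have hfc := hf.sub_const c
  have h1 := sphereIntegral_twoForm_grad hm hr hω hfc hg
  rw [grad_sub_const] at h1
  have hcont := hfc.continuousOnSphere
  have hgc := hg.continuousOnSphere_norm_grad_sq hr
  rw [h1, ← sphereIntegral_const_mul]
  have hpt : ∀ x, ‖x‖ = r → -2 * ((f x - c) * codifferential r ω x (grad r g x)) ≤
      Θ * s * (f x - c) ^ 2 + Θ / s * ‖grad r g x‖ ^ 2 := by
    intro x hx
    have h2 := hδ x _ hx (inner_self_grad hr hg hx)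
    have h3 : -2 * ((f x - c) * codifferential r ω x (grad r g x)) ≤
        2 * (|f x - c| * (Θ * ‖grad r g x‖)) := by
      have h4 := neg_abs_le ((f x - c) * codifferential r ω x (grad r g x))
      rw [abs_mul] at h4
      have h5 := mul_le_mul_of_nonneg_left h2 (abs_nonneg (f x - c))
      linarith
    -- Young's inequality, weighted so that the Poincaré constant `s ^ 2` balances the two energies.
    have h6 : 0 ≤ Θ / s * (s * |f x - c| - ‖grad r g x‖) ^ 2 := by positivity
    have h7 : Θ / s * (s * |f x - c| - ‖grad r g x‖) ^ 2 =
        Θ * s * (f x - c) ^ 2 + Θ / s * ‖grad r g x‖ ^ 2 -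
          2 * (|f x - c| * (Θ * ‖grad r g x‖)) := by
      rw [← sq_abs (f x - c)]
      field_simp
      ring
    linarith
  refine (sphereIntegral_mono hr ((continuousOnSphere_const (-2)).mul
    (hcont.mul (continuousOnSphere_codifferential_grad hm hr hω hg)))
    (((continuousOnSphere_const (Θ * s)).mul (hcont.pow 2)).add
      ((continuousOnSphere_const (Θ / s)).mul hgc)) hpt).trans ?_
  rw [sphereIntegral_add ((continuousOnSphere_const (Θ * s)).mul (hcont.pow 2))
    ((continuousOnSphere_const (Θ / s)).mul hgc), sphereIntegral_const_mul,
    sphereIntegral_const_mul, mul_add]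
  refine add_le_add_left ?_ _
  have h8 := mul_le_mul_of_nonneg_left hc (show 0 ≤ Θ / s by positivity)
  refine le_trans (le_of_eq ?_) h8
  field_simp

end CauchyRiemann

end SphereCalibration

/-! ### The long integral Cauchy–Riemann inequality -/

open SphereCalibration

theorem corollary2p2 (m n : ℕ) (hm : 2 ≤ m) (hn : 1 ≤ n) (r : ℝ) (hr : 0 < r)
    (Ω : Euc (m + n) →
      Euc (m + n) [⋀^Fin (m + 1)]→L[ℝ] ℝ)
    (hΩ : IsSemicalibration Ω)
    (φ : Euc (m + 1) →ₗᵢ[ℝ] Euc (m + n))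
    (hφ : IsCalibrated Ω φ)
    (W : Fin (n - 1) → Euc (m + n)) (hW : Orthonormal ℝ W)
    (hWφ : ∀ α x, ⟪W α, φ x⟫ = 0)
    (ω : Fin (n - 1) → Fin (n - 1) → Euc (m + 1) →
      Euc (m + 1) [⋀^Fin 2]→L[ℝ] ℝ)
    (hω : ∀ α β, α < β → IsTwoForm r (ω α β))
    (hξ : ∀ α β, α < β → ∀ x v : Euc (m + 1), ‖x‖ = r → ⟪x, v⟫ = 0 →
      xi Ω φ r (W α) (W β) x v =
        codifferential r (ω α β) x v)
    (l : ℕ) (f : Fin (n - 1) → Euc (m + 1) → ℝ)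
    (hf : ∀ α, MemEplus r l (f α)) :
    (1 ≤ l →
      longForm r ω f ≤
        (m : ℝ) * ((n : ℝ) - 2) / √(eigval m 1 l) *
          Theta Ω φ r W * energy r f) ∧
    ((m : ℝ) ^ 2 * ((n : ℝ) - 2) ^ 2 ≤ (l : ℝ) * ((l : ℝ) + (m : ℝ) - 1) →
      longForm r ω f ≤ energy r f) := by
  have hm1 : 1 ≤ m := by omega
  have hΘ0 := Theta_nonneg Ω φ r W
  have hΘ1 := Theta_le_one hm1 hr hΩ φ hW hWφ
  have hE := energy_nonneg hr f
  have hL1 : eigval m 1 l = (l : ℝ) * ((l : ℝ) + (m : ℝ) - 1) := by simp [eigval]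
  have part1 : 1 ≤ l → longForm r ω f ≤
      (m : ℝ) * ((n : ℝ) - 2) / √(eigval m 1 l) * Theta Ω φ r W * energy r f := by
    intro hl
    set Θ := Theta Ω φ r W
    have hLpos : 0 < eigval m 1 l := eigval_pos hm1 one_pos hl
    set q := √(eigval m 1 l) with hq
    have hq0 : 0 < q := Real.sqrt_pos.2 hLpos
    -- The Poincaré constant at radius `r` is `(√λ_l / r)²`; the factor `m / r` of the form later
    -- cancels this `r`.
    have hs2 : (q / r) ^ 2 = eigval m r l := by
      rw [div_pow, hq, Real.sq_sqrt hLpos.le, hL1, eigval]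
    have hterm : ∀ α, ∀ β ∈ Finset.Ioi α, -2 * (m : ℝ) * (1 / r) *
        sphereIntegral r (fun x => ω α β x ![grad r (f α) x, grad r (f β) x]) ≤
          m * Θ / q * (sphereIntegral r (fun x => ‖grad r (f α) x‖ ^ 2) +
            sphereIntegral r (fun x => ‖grad r (f β) x‖ ^ 2)) := by
      intro α β hβ
      have hαβ := Finset.mem_Ioi.1 hβ
      obtain ⟨c, hc⟩ := (hf α).exists_poincare hm1 hr hl
      rw [← hs2] at hc
      have hδ : ∀ x v : Euc (m + 1), ‖x‖ = r → ⟪x, v⟫ = 0 →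
          |codifferential r (ω α β) x v| ≤ Θ * ‖v‖ := by
        intro x v hx hv
        rw [← hξ α β hαβ x v hx hv]
        exact ContinuousLinearMap.le_of_opNorm_le _
          (norm_xi_le_Theta hm1 hr hΩ φ hW hWφ hαβ hx) v
      have h := neg_two_mul_sphereIntegral_twoForm_grad_le hm1 hr (hω α β hαβ) hΘ0 hδ
        (hf α).smooth (hf β).smooth (div_pos hq0 hr) hc
      have h' := mul_le_mul_of_nonneg_left h (show 0 ≤ (m : ℝ) / r by positivity)
      refine (le_of_eq ?_).trans (h'.trans (le_of_eq ?_))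
      · ring
      · field_simp
    have hN : ((n - 1 : ℕ) : ℝ) - 1 = n - 2 := by
      rw [Nat.cast_sub hn]
      push_cast
      ring
    refine (Finset.sum_le_sum fun α _ => Finset.sum_le_sum (hterm α)).trans (le_of_eq ?_)
    simp only [← Finset.mul_sum]
    rw [sum_Ioi_add, hN, energy]
    ring
  refine ⟨part1, fun h => ?_⟩
  -- For `l = 0` the first part is unavailable, but the hypothesis forces `n = 2`: there is a single
  -- normal direction and no pair.
  rcases Nat.eq_zero_or_pos l with rfl | hl
  · have hm0 : (0 : ℝ) < (m : ℝ) ^ 2 := by positivity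
    have h0 : ((n : ℝ) - 2) ^ 2 = 0 := by
      rw [Nat.cast_zero, zero_mul] at h
      exact le_antisymm (by nlinarith [sq_nonneg ((n : ℝ) - 2)]) (sq_nonneg _)
    have hn2 : n = 2 := by
      have : (n : ℝ) = 2 := by linarith [pow_eq_zero_iff (two_ne_zero) |>.1 h0]
      exact_mod_cast this
    have hlong : longForm r ω f = 0 := by
      refine Finset.sum_eq_zero fun α _ => Finset.sum_eq_zero fun β hβ => ?_
      have := Finset.mem_Ioi.1 hβ
      have h1 := α.2
      have h2 := β.2
      omega
    rw [hlong]
    exact hE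
  · refine (part1 hl).trans (mul_le_of_le_one_left hE ?_)
    have hq0 : 0 < √(eigval m 1 l) := Real.sqrt_pos.2 (eigval_pos hm1 one_pos hl)
    have h1 : (m : ℝ) * ((n : ℝ) - 2) / √(eigval m 1 l) ≤ 1 := by
      rw [div_le_one hq0]
      exact Real.le_sqrt_of_sq_le (by rw [hL1, mul_pow]; exact h)
    exact (mul_le_mul_of_nonneg_right h1 hΘ0).trans (by rw [one_mul]; exact hΘ1)
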